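/- **Setting.** Let $\mathbf V$ be a countably infinite set of values. A schema $\mathbf S$ is a finite set of relation symbols $R$ with arities $\mathrm{ar}(R)\ge 0$; we assume that some symbol has positive arity (otherwise there are no pointed databases). An $\mathbf S$-database $D$ is a finite set of facts $R(\bar v)$, $R\in\mathbf S$, $\bar v\in\mathbf V^{\mathrm{ar}(R)}$; $\mathrm{adom}(D)$ is the set of values that occur in its facts; its degree is the maximum number of facts that a value occurs in; its Gaifman graph has vertex set $\mathrm{adom}(D)$, two distinct values being adjacent if they occur together in a fact. A pointed database $D^v$ is a database with a value $v\in\mathrm{adom}(D)$. A homomorphism $F^u\to D^v$ is a map $h:\mathrm{adom}(F)\to\mathrm{adom}(D)$ with $h(u)=v$ that maps facts of $F$ to facts of $D$. **DHNs.** A homomorphism query with input dimension $d\ge 0$ and output dimension $d'>0$ is $(F^\bullet,\mu,\mathrm{agg})$ with $F^\bullet$ a pointed database, functions $\mu_a:\mathbb R^d\to\mathbb R^{d'}$ for $a\in\mathrm{adom}(F)$, and $\mathrm{agg}$ a function from finite multisets of reals to reals. On $D$ with an embedding $\lambda:\mathrm{adom}(D)\to\mathbb R^d$, at $v$, it returns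 (component-wise) $\mathrm{agg}\{\!\{\prod_{a\in\mathrm{adom}(F)}\mu_a(\lambda(h(a)))\mid h\in\mathrm{Hom}(F^\bullet,D^v)\}\!\}$. A layer consists of finitely many queries with input dimension $d$ and output dimensions $d_1,\dots,d_m$, and a combination function $\mathrm{com}:\mathbb R^{d_1}\times\dots\times\mathbb R^{d_m}\to\mathbb R^{d'}$; it maps $\lambda$ to the embedding that sends $v$ to $\mathrm{com}$ of the query results at $v$. A deep homomorphism network (DHN) is a finite sequence of layers with matching dimensions and input dimension $0$, followed by a classification function $\mathbb R^{d'}\to\{0,1\}$; it accepts $D^v$ if the vector finally computed at $v$, starting from empty vectors, is classified as $1$. It is a sum-DHN (max-DHN) if all its aggregation functions are the sum (the maximum, with $\max\emptyset=0$). It is connected if the Gaifman graphs of all $F$ in its queries are connected. It is simple if all transformation functions are of the form $\bar x\mapsto\mathrm{ReLU}^*(\bar xA+\bar b)$ and all combination functions of the form $(\bar x_1,\dots,\bar x_m)\mapsto\mathrm{ReLU}^*(\sum_i\bar x_iA_i+\bar b)$ with rational matrices and vectors, where $\mathrm{ReLU}^*(x)=\min(\max(0,x),1)$ is applied component-wise,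 and the classification function accepts iff $x_i>c$, or iff $x_i\ge c$, for a fixed component $i$ and $c\in\mathbb Q$. **Logics.** All quantifiers range over the active domain; formulas have one free variable $x$. UNFOC is given by $\varphi::=R(\bar x)\mid\varphi\wedge\varphi\mid\varphi\vee\varphi\mid\exists^{\ge n}y\,\varphi\mid\neg\varphi(x_i)$ with $n\in\mathbb N$, where in the last case $\varphi$ has at most the free variable $x_i$; UNFO is the fragment in which only $n=1$ is used. HML is given by $\varphi(x)::=\neg\varphi(x)\mid\varphi(x)\vee\varphi(x)\mid\exists\bar y\,\psi(x,\bar y)$ with $\psi$ a conjunction of relational atoms and of HML formulas $\varphi(z)$, $z\in\{x\}\cup\bar y$. GHML is defined in the same way, with $\exists^{\ge k_1}y_1\cdots\exists^{\ge k_m}y_m\bigvee_{i}\psi_i(x,y_1,\dots,y_m)$, $k_j\in\mathbb N$, in place of $\exists\bar y\,\psi$. A GHML formula is connected if in each of its subformulas of the latter form all $k_j$ are positive and, for every $i$, each of $x,y_1,\dots,y_m$ occurs in a relational atom of $\psi_i$ and the Gaifman graph of the set of relational atoms of $\psi_i$ is connected. **Expressive power.** A class $\mathcal C_2$ of classifiers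 of pointed databases is at least as expressive as $\mathcal C_1$ if every set of pointed databases that is defined by a member of $\mathcal C_1$ is defined by a member of $\mathcal C_2$; they have the same expressive power if this holds in both directions. *On databases of bounded degree* means: for every $B\in\mathbb N$, this holds when only pointed databases of degree at most $B$ are considered (the equivalent classifier may depend on $B$). **Theorem.** 1. max-DHNs, simple max-DHNs, UNFO and HML all have the same expressive power. 2. Simple sum-DHNs are at least as expressive as GHML and as UNFOC. 3. On databases of bounded degree, connected sum-DHNs, simple connected sum-DHNs and connected GHML have the same expressive power. -/

import Mathlib

namespace HomNet

universe u v

/-! ### Schemas, databases, homomorphisms -/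

/-- A schema: a finite set of relation symbols with arities (arity zero is allowed). -/
structure Schema where
  Rel : Type u
  finite : Finite Rel
  ar : Rel → ℕ

/-- A fact `R(v₁, …, vₙ)` with values from `V`. -/
abbrev Fact (S : Schema.{u}) (V : Type v) : Type (max u v) :=
  Σ R : S.Rel, (Fin (S.ar R) → V)

/-- A database is a finite set of facts. -/
abbrev Database (S : Schema.{u}) (V : Type v) : Type (max u v) :=
  Finset (Fact S V)

open scoped Classical in
/-- The active domain: the set of values used in the facts of the database. -/
noncomputable def adom {S : Schema.{u}} {V : Type v} (D : Database S V) : Finset V :=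
  D.biUnion fun f => Finset.univ.image f.2

open scoped Classical in
/-- The degree of a database: the maximum number of facts that any value occurs in. -/
noncomputable def degree {S : Schema.{u}} {V : Type v} (D : Database S V) : ℕ :=
  (adom D).sup fun a => (D.filter fun f => ∃ i, f.2 i = a).card

/-- The Gaifman graph: the vertices are the values of the active domain, and two
distinct values are adjacent if they occur together in some fact. -/
def gaifman {S : Schema.{u}} {V : Type v} (D : Database S V) :
    SimpleGraph {a : V // a ∈ adom D} where
  Adj a b := a ≠ b ∧ ∃ f ∈ D, (∃ i, f.2 i = a.1) ∧ ∃ j, f.2 j = b.1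
  symm := ⟨fun _ _ h => ⟨h.1.symm, h.2.imp fun _ hf => ⟨hf.1, hf.2.2, hf.2.1⟩⟩⟩
  loopless := ⟨fun _ h => h.1 rfl⟩

/-- A pointed database: a database with a distinguished value of its active domain. -/
structure PointedDatabase (S : Schema.{u}) (V : Type v) where
  db : Database S V
  pt : {a : V // a ∈ adom db}

/-- Homomorphisms between pointed databases: maps between the active domains that
preserve the distinguished value and all facts. -/
abbrev Hom {S : Schema.{u}} {V : Type v} (F D : PointedDatabase S V) : Type v :=
  {h : {a : V // a ∈ adom F.db} → {a : V // a ∈ adom D.db} //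
    h F.pt = D.pt ∧
    ∀ (R : S.Rel) (t : Fin (S.ar R) → {a : V // a ∈ adom F.db}),
      (⟨R, fun i => (t i).1⟩ : Fact S V) ∈ F.db →
      (⟨R, fun i => (h (t i)).1⟩ : Fact S V) ∈ D.db}

/-! ### Deep homomorphism networks -/

/-- Aggregation functions on finite multisets of reals. -/
abbrev Aggregation : Type := Multiset ℝ → ℝ

/-- Sum aggregation. -/
noncomputable def sumAgg : Aggregation := fun M => M.sum

/-- Maximum aggregation; the set of elements of `M` is finite, so the supremum is the
maximum if `M` is non-empty, and it is `0` if `M` is empty. -/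
noncomputable def maxAgg : Aggregation := fun M => sSup {x : ℝ | x ∈ M}

/-- A homomorphism query with input dimension `d` and output dimension `d'`. -/
structure HomQuery (S : Schema.{u}) (V : Type v) (d d' : ℕ) where
  out_pos : 0 < d'
  F : PointedDatabase S V
  trans : {a : V // a ∈ adom F.db} → (Fin d → ℝ) → (Fin d' → ℝ)
  agg : Aggregation

open scoped Classical in
/-- Evaluation of a homomorphism query on the database `D` with embedding `lam`, pointed
at `w`; products and aggregation are component-wise. -/
noncomputable def HomQuery.eval {S : Schema.{u}} {V : Type v} {d d' : ℕ}
    (q : HomQuery S V d d') (D : Database S V)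
    (lam : {a : V // a ∈ adom D} → Fin d → ℝ) (w : {a : V // a ∈ adom D}) : Fin d' → ℝ :=
  fun j => q.agg ((Finset.univ : Finset (Hom q.F ⟨D, w⟩)).val.map
    fun h => ∏ a : {a : V // a ∈ adom q.F.db}, q.trans a (lam (h.1 a)) j)

/-- A layer with input dimension `d` and output dimension `d'`: finitely many homomorphism
queries and a combination function. -/
structure Layer (S : Schema.{u}) (V : Type v) (d d' : ℕ) where
  m : ℕ
  out : Fin m → ℕ
  query : (i : Fin m) → HomQuery S V d (out i)
  com : ((i : Fin m) → Fin (out i) → ℝ) → (Fin d' → ℝ)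

/-- The embedding produced by a layer. -/
noncomputable def Layer.apply {S : Schema.{u}} {V : Type v} {d d' : ℕ} (L : Layer S V d d')
    (D : Database S V) (lam : {a : V // a ∈ adom D} → Fin d → ℝ) :
    {a : V // a ∈ adom D} → Fin d' → ℝ :=
  fun w => L.com fun i => (L.query i).eval D lam w

/-- Finite sequences of layers with matching dimensions, with input dimension `0`; the
index is the output dimension. -/
inductive Layers (S : Schema.{u}) (V : Type v) : ℕ → Type (max u v)
  | nil : Layers S V 0
  | snoc {d d' : ℕ} (N : Layers S V d) (L : Layer S V d d') : Layers S V d'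

/-- The embedding of a database computed by a sequence of layers, starting with the
embedding that assigns the empty vector to every value. -/
noncomputable def Layers.embed {S : Schema.{u}} {V : Type v} (D : Database S V) :
    {d : ℕ} → Layers S V d → {a : V // a ∈ adom D} → Fin d → ℝ
  | _, .nil => fun _ => Fin.elim0
  | _, .snoc N L => L.apply D (Layers.embed D N)

/-- A property of layers holds for all layers of the sequence. -/
def Layers.All {S : Schema.{u}} {V : Type v} (P : ∀ {d d' : ℕ}, Layer S V d d' → Prop) :
    {d : ℕ} → Layers S V d → Prop
  | _, .nil => True
  | _, .snoc N L => Layers.All P N ∧ P L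

/-- A deep homomorphism network: a sequence of layers and a classification function. -/
structure DHN (S : Schema.{u}) (V : Type v) where
  dim : ℕ
  layers : Layers S V dim
  cls : (Fin dim → ℝ) → Bool

/-- Acceptance of a pointed database. -/
def DHN.Accepts {S : Schema.{u}} {V : Type v} (N : DHN S V) (X : PointedDatabase S V) : Prop :=
  N.cls (N.layers.embed X.db X.pt) = true

/-- `agg` is the only aggregation function used in the network. -/
def DHN.UsesOnly {S : Schema.{u}} {V : Type v} (agg : Aggregation) (N : DHN S V) : Prop :=
  N.layers.All fun L => ∀ i, (L.query i).agg = agg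

/-- The network is connected: the Gaifman graph of the pattern of every homomorphism query
in it is connected. -/
def DHN.IsConnected {S : Schema.{u}} {V : Type v} (N : DHN S V) : Prop :=
  N.layers.All fun L => ∀ i, (gaifman (L.query i).F.db).Connected

/-- Truncated ReLU. -/
noncomputable def reluStar (x : ℝ) : ℝ := min (max 0 x) 1

/-- A simple transformation function: `t(x) = ReLU*(x · A + b)` with rational `A` and `b`. -/
def IsSimpleTrans {d d' : ℕ} (t : (Fin d → ℝ) → (Fin d' → ℝ)) : Prop :=
  ∃ (A : Matrix (Fin d) (Fin d') ℚ) (b : Fin d' → ℚ),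
    ∀ x j, t x j = reluStar (∑ k, x k * (A k j : ℝ) + (b j : ℝ))

/-- A simple combination function: `ReLU*(x₁ · A₁ + ⋯ + xₘ · Aₘ + b)`, all rational. -/
def IsSimpleCom {m d' : ℕ} {out : Fin m → ℕ}
    (com : ((i : Fin m) → Fin (out i) → ℝ) → (Fin d' → ℝ)) : Prop :=
  ∃ (A : (i : Fin m) → Matrix (Fin (out i)) (Fin d') ℚ) (b : Fin d' → ℚ),
    ∀ x j, com x j = reluStar (∑ i, ∑ k, x i k * (A i k j : ℝ) + (b j : ℝ))

/-- A simple classification function: a rational threshold on one component. -/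
def IsSimpleCls {d : ℕ} (cls : (Fin d → ℝ) → Bool) : Prop :=
  ∃ (c : ℚ) (i : Fin d),
    (∀ x, cls x = true ↔ x i > (c : ℝ)) ∨ (∀ x, cls x = true ↔ x i ≥ (c : ℝ))

/-- Simple networks. -/
def DHN.IsSimple {S : Schema.{u}} {V : Type v} (N : DHN S V) : Prop :=
  (N.layers.All fun L => IsSimpleCom L.com ∧ ∀ i a, IsSimpleTrans ((L.query i).trans a)) ∧
    IsSimpleCls N.cls

/-! ### Logics -/

/-- `∃^{≥ n} y, P y`, with `y` ranging over the active domain of `D`. -/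
def AtLeast {S : Schema.{u}} {V : Type v} (D : Database S V) (n : ℕ)
    (P : {a : V // a ∈ adom D} → Prop) : Prop :=
  n ≤ Set.ncard {y | P y}

/-- Formulas of the unary negation fragment with counting, with free variables among
`x₀, …, xₙ₋₁`. In `ex k φ`, the bound variable of `φ` is the last one, `xₙ`. In `neg i φ`, the
formula `φ` has at most one free variable, which is the variable `xᵢ` of the context. -/
inductive UNFOC (S : Schema.{u}) : ℕ → Type u
  | rel {n : ℕ} (R : S.Rel) (x : Fin (S.ar R) → Fin n) : UNFOC S n
  | and {n : ℕ} (φ ψ : UNFOC S n) : UNFOC S n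
  | or {n : ℕ} (φ ψ : UNFOC S n) : UNFOC S n
  | ex {n : ℕ} (k : ℕ) (φ : UNFOC S (n + 1)) : UNFOC S n
  | neg {n : ℕ} (i : Fin n) (φ : UNFOC S 1) : UNFOC S n

/-- Satisfaction (active domain semantics). -/
def UNFOC.Sat {S : Schema.{u}} {V : Type v} (D : Database S V) :
    {n : ℕ} → UNFOC S n → (Fin n → {a : V // a ∈ adom D}) → Prop
  | _, .rel R x, e => (⟨R, fun i => (e (x i)).1⟩ : Fact S V) ∈ D
  | _, .and φ ψ, e => φ.Sat D e ∧ ψ.Sat D e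
  | _, .or φ ψ, e => φ.Sat D e ∨ ψ.Sat D e
  | _, .ex k φ, e => AtLeast D k fun y => φ.Sat D (Fin.snoc e y)
  | _, .neg i φ, e => ¬ φ.Sat D fun _ => e i

/-- The formulas of the unary negation fragment without counting: all counting
quantifiers are `∃^{≥ 1}`. -/
def UNFOC.IsUNFO {S : Schema.{u}} : {n : ℕ} → UNFOC S n → Prop
  | _, .rel _ _ => True
  | _, .and φ ψ => φ.IsUNFO ∧ ψ.IsUNFO
  | _, .or φ ψ => φ.IsUNFO ∧ ψ.IsUNFO
  | _, .ex k φ => k = 1 ∧ φ.IsUNFO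
  | _, .neg _ φ => φ.IsUNFO

/-- Formulas `φ(x)` of homomorphism modal logic. In `ex m atoms p var sub`, which is
`∃ y₁ ⋯ yₘ ψ(x, y₁, …, yₘ)`, the variable `x` has index `0` and `yⱼ` has index `j`; the
formula `ψ` is the conjunction of the relational atoms in `atoms` and of the unary formulas
`sub j` applied to the variables `var j`. -/
inductive HML (S : Schema.{u}) : Type u
  | neg (φ : HML S) : HML S
  | or (φ ψ : HML S) : HML S
  | ex (m : ℕ) (atoms : Database S (Fin (m + 1))) (p : ℕ)
      (var : Fin p → Fin (m + 1)) (sub : Fin p → HML S) : HML S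

/-- Satisfaction (active domain semantics). -/
def HML.Sat {S : Schema.{u}} {V : Type v} (D : Database S V) :
    HML S → {a : V // a ∈ adom D} → Prop
  | .neg φ, w => ¬ φ.Sat D w
  | .or φ ψ, w => φ.Sat D w ∨ ψ.Sat D w
  | .ex m atoms _ var sub, w => ∃ y : Fin m → {a : V // a ∈ adom D},
      let e : Fin (m + 1) → {a : V // a ∈ adom D} := Fin.cons w y
      (∀ f ∈ atoms, (⟨f.1, fun i => (e (f.2 i)).1⟩ : Fact S V) ∈ D) ∧
        ∀ j, (sub j).Sat D (e (var j))

/-- The quantifier block `∃^{≥ k₁} y₁ ⋯ ∃^{≥ kₘ} yₘ, P (y₁, …, yₘ)`. -/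
def CountBlock {S : Schema.{u}} {V : Type v} (D : Database S V) :
    (m : ℕ) → (Fin m → ℕ) → ((Fin m → {a : V // a ∈ adom D}) → Prop) → Prop
  | 0, _, P => P Fin.elim0
  | m + 1, k, P => AtLeast D (k 0) fun y =>
      CountBlock D m (fun i => k i.succ) fun ys => P (Fin.cons y ys)

/-- Formulas `φ(x)` of graded homomorphism modal logic. The formula
`ex m k l atoms p var sub` is `∃^{≥ k₁} y₁ ⋯ ∃^{≥ kₘ} yₘ ⋁ᵢ ψᵢ(x, y₁, …, yₘ)` with `l` disjuncts;
the variable `x` has index `0` and `yⱼ` has index `j`, and `ψᵢ` is the conjunction of the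
relational atoms in `atoms i` and of the unary formulas `sub i j` applied to the variables
`var i j`. -/
inductive GHML (S : Schema.{u}) : Type u
  | neg (φ : GHML S) : GHML S
  | or (φ ψ : GHML S) : GHML S
  | ex (m : ℕ) (k : Fin m → ℕ) (l : ℕ) (atoms : Fin l → Database S (Fin (m + 1)))
      (p : Fin l → ℕ) (var : (i : Fin l) → Fin (p i) → Fin (m + 1))
      (sub : (i : Fin l) → Fin (p i) → GHML S) : GHML S

/-- Satisfaction (active domain semantics). -/
def GHML.Sat {S : Schema.{u}} {V : Type v} (D : Database S V) :
    GHML S → {a : V // a ∈ adom D} → Prop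
  | .neg φ, w => ¬ φ.Sat D w
  | .or φ ψ, w => φ.Sat D w ∨ ψ.Sat D w
  | .ex m k _ atoms _ var sub, w => CountBlock D m k fun y =>
      let e : Fin (m + 1) → {a : V // a ∈ adom D} := Fin.cons w y
      ∃ i, (∀ f ∈ atoms i, (⟨f.1, fun j => (e (f.2 j)).1⟩ : Fact S V) ∈ D) ∧
        ∀ j, (sub i j).Sat D (e (var i j))

/-- Connected formulas of graded homomorphism modal logic: in every existentially
quantified subformula all counting bounds are positive and, for every disjunct `ψᵢ`, each of
the variables `x, y₁, …, yₘ` occurs in some relational atom of `ψᵢ`, and the Gaifman graph of the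
relational atoms of `ψᵢ` is connected. -/
def GHML.IsConnected {S : Schema.{u}} : GHML S → Prop
  | .neg φ => φ.IsConnected
  | .or φ ψ => φ.IsConnected ∧ ψ.IsConnected
  | .ex _ k _ atoms _ _ sub => (∀ j, 1 ≤ k j) ∧
      ∀ i, (adom (atoms i) = Finset.univ ∧ (gaifman (atoms i)).Connected) ∧
        ∀ j, (sub i j).IsConnected

/-! ### Value properties and expressive power -/

/-- A value property: a set of pointed databases. -/
abbrev ValueProperty (S : Schema.{u}) (V : Type v) : Type (max u v) :=
  Set (PointedDatabase S V)

/-- `C₂` is at least as expressive as `C₁` on the pointed databases in `K`, where a class of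
value classifiers is given by the set of the value properties that its members express. -/
def AtLeastAsExpressiveOn {S : Schema.{u}} {V : Type v} (K : Set (PointedDatabase S V))
    (C₂ C₁ : Set (ValueProperty S V)) : Prop :=
  ∀ P ∈ C₁, ∃ Q ∈ C₂, ∀ X ∈ K, X ∈ Q ↔ X ∈ P

/-- `C₁` and `C₂` have the same expressive power on the pointed databases in `K`. -/
def SameExpressivePowerOn {S : Schema.{u}} {V : Type v} (K : Set (PointedDatabase S V))
    (C₁ C₂ : Set (ValueProperty S V)) : Prop :=
  AtLeastAsExpressiveOn K C₁ C₂ ∧ AtLeastAsExpressiveOn K C₂ C₁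

/-- At least as expressive, on all pointed databases. -/
def AtLeastAsExpressive {S : Schema.{u}} {V : Type v} (C₂ C₁ : Set (ValueProperty S V)) : Prop :=
  AtLeastAsExpressiveOn Set.univ C₂ C₁

/-- The same expressive power, on all pointed databases. -/
def SameExpressivePower {S : Schema.{u}} {V : Type v} (C₁ C₂ : Set (ValueProperty S V)) : Prop :=
  SameExpressivePowerOn Set.univ C₁ C₂

/-- The value properties expressed by the networks that satisfy `p`. -/
def dhnClass {S : Schema.{u}} {V : Type v} (p : DHN S V → Prop) : Set (ValueProperty S V) :=
  {P | ∃ N : DHN S V, p N ∧ P = {X | N.Accepts X}}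

/-- The max-DHNs. -/
def maxDHN (S : Schema.{u}) (V : Type v) : Set (ValueProperty S V) :=
  dhnClass fun N => N.UsesOnly maxAgg

/-- The simple max-DHNs. -/
def simpleMaxDHN (S : Schema.{u}) (V : Type v) : Set (ValueProperty S V) :=
  dhnClass fun N => N.UsesOnly maxAgg ∧ N.IsSimple

/-- The simple sum-DHNs. -/
def simpleSumDHN (S : Schema.{u}) (V : Type v) : Set (ValueProperty S V) :=
  dhnClass fun N => N.UsesOnly sumAgg ∧ N.IsSimple

/-- The connected sum-DHNs. -/
def connectedSumDHN (S : Schema.{u}) (V : Type v) : Set (ValueProperty S V) :=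
  dhnClass fun N => N.UsesOnly sumAgg ∧ N.IsConnected

/-- The simple connected sum-DHNs. -/
def simpleConnectedSumDHN (S : Schema.{u}) (V : Type v) : Set (ValueProperty S V) :=
  dhnClass fun N => N.UsesOnly sumAgg ∧ N.IsConnected ∧ N.IsSimple

/-- The UNFOC formulas in one free variable. -/
def unfocClass (S : Schema.{u}) (V : Type v) : Set (ValueProperty S V) :=
  {P | ∃ φ : UNFOC S 1, P = {X | φ.Sat X.db fun _ => X.pt}}

/-- The UNFO formulas in one free variable. -/
def unfoClass (S : Schema.{u}) (V : Type v) : Set (ValueProperty S V) :=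
  {P | ∃ φ : UNFOC S 1, φ.IsUNFO ∧ P = {X | φ.Sat X.db fun _ => X.pt}}

/-- The HML formulas. -/
def hmlClass (S : Schema.{u}) (V : Type v) : Set (ValueProperty S V) :=
  {P | ∃ φ : HML S, P = {X | φ.Sat X.db X.pt}}

/-- The GHML formulas. -/
def ghmlClass (S : Schema.{u}) (V : Type v) : Set (ValueProperty S V) :=
  {P | ∃ φ : GHML S, P = {X | φ.Sat X.db X.pt}}

/-- The connected GHML formulas. -/
def connectedGhmlClass (S : Schema.{u}) (V : Type v) : Set (ValueProperty S V) :=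
  {P | ∃ φ : GHML S, φ.IsConnected ∧ P = {X | φ.Sat X.db X.pt}}

/-- The pointed databases of degree at most `B`. -/
def boundedDegree (S : Schema.{u}) (V : Type v) (B : ℕ) : Set (PointedDatabase S V) :=
  {X | degree X.db ≤ B}

end HomNet

open HomNet

namespace HomNet

universe u v

/-! ### Patterns and conjunctions, with their satisfying assignments counted -/

section Patterns

variable {S : Schema.{u}} {V : Type v} {ι κ : Type}

/-! A conjunction of relational atoms is a pattern, and a homomorphism query counts the
homomorphisms from a pattern (sum) or detects one (max). This links logic and networks in both
directions.

From logic to networks, all embedding components are kept equal to 0 or 1, as characteristic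
functions of value properties. A truncated affine map at each value of the pattern tests the
properties required there, so the product is 1 exactly for the homomorphisms that meet all
requirements; the sum is their number, the maximum that number cut off at 1 (`AggSpec`,
`exists_query`). A simple layer then computes ReLU* of any rational linear combination of such
counts plus a rational constant (`exists_layer`). Boolean operations have this form. For the sum, an
inequality `a ≠ b` is eliminated by subtracting the count for the pattern with `a` and `b`
identified (`count_mem_span`), so `k` pairwise distinct witnesses can be demanded. Formulas become
finite disjunctions of existential conjunctions (`HasNormalForm`); negation applies only to unary
formulas, which earlier layers have turned into embedding components. For connected formulas all
patterns stay connected.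

From networks to logic, the embedding after each layer depends on finitely many definable properties
only (`FinDetermined.embed`). Their truth values give every value one of finitely many types, and a
query result depends only on how often each assignment of types to the pattern occurs among the
homomorphisms. For max only occurrence matters, which an HML formula expresses. For sum the numbers
matter; in bounded degree a connected pattern maps into a ball of bounded size, and the number is
recovered from the truth values of finitely many counting blocks (`card_eq_card_countBlock`).

The direct translation of HML into UNFO (`HML.unfoDefinable`) closes the circle of inclusions for
max. -/

instance : Finite S.Rel := S.finite

/-- Renaming the values of a fact. -/
def Fact.map {α β : Type*} (ρ : α → β) (f : Fact S α) : Fact S β := ⟨f.1, ρ ∘ f.2⟩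

theorem mem_adom {α : Type*} {D : Database S α} {a : α} :
    a ∈ adom D ↔ ∃ f ∈ D, ∃ i, f.2 i = a := by
  classical
  simp [adom]

/-- Two values occur together in one of the facts. -/
def Cooc {α : Type*} (A : Set (Fact S α)) (a b : α) : Prop :=
  ∃ f ∈ A, (∃ i, f.2 i = a) ∧ ∃ j, f.2 j = b

theorem Cooc.map {α β : Type*} {A : Set (Fact S α)} {B : Set (Fact S β)} {ρ : α → β}
    (h : ∀ f ∈ A, Fact.map ρ f ∈ B) {a b : α} (hab : Cooc A a b) : Cooc B (ρ a) (ρ b) := by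
  obtain ⟨f, hf, ⟨i, rfl⟩, j, rfl⟩ := hab
  exact ⟨_, h f hf, ⟨i, rfl⟩, j, rfl⟩

/-- A presentation of the database `D` by facts over `ι`. -/
structure Presentation {W : Type*} (D : Database S W) (A : Set (Fact S ι)) where
  e : ι ≃ {a : W // a ∈ adom D}
  mem_iff : ∀ f, f ∈ A ↔ Fact.map (fun a => (e a).1) f ∈ D

namespace Presentation

variable {W : Type*} {D : Database S W} {A : Set (Fact S ι)}

theorem exists_eq_map (p : Presentation D A) {f : Fact S W} (hf : f ∈ D) :
    ∃ f' ∈ A, f = Fact.map (fun a => (p.e a).1) f' := by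
  have h : ∀ i, ∃ a, (p.e a).1 = f.2 i := fun i =>
    ⟨p.e.symm ⟨f.2 i, mem_adom.2 ⟨f, hf, i, rfl⟩⟩, by simp⟩
  choose t ht using h
  have : f = Fact.map (fun a => (p.e a).1) (⟨f.1, t⟩ : Fact S ι) := by
    obtain ⟨R, x⟩ := f
    simp only [Fact.map, Sigma.mk.injEq, heq_eq_eq, true_and]
    funext i
    exact (ht i).symm
  exact ⟨_, (p.mem_iff _).2 (this ▸ hf), this⟩

theorem cooc_iff (p : Presentation D A) {a b : ι} :
    Cooc A a b ↔ Cooc (D : Set (Fact S W)) (p.e a).1 (p.e b).1 := by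
  constructor
  · exact Cooc.map fun f hf => (p.mem_iff f).1 hf
  · rintro ⟨f, hf, ⟨i, hi⟩, j, hj⟩
    obtain ⟨f', hf', rfl⟩ := p.exists_eq_map hf
    exact ⟨f', hf', ⟨i, p.e.injective (Subtype.ext hi)⟩, j, p.e.injective (Subtype.ext hj)⟩

theorem covered (p : Presentation D A) (a : ι) : ∃ f ∈ A, ∃ i, f.2 i = a := by
  obtain ⟨f, hf, i, hi⟩ := mem_adom.1 (p.e a).2
  obtain ⟨f', hf', rfl⟩ := p.exists_eq_map hf
  exact ⟨f', hf', i, p.e.injective (Subtype.ext hi)⟩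

/-- `Cooc` also relates a value to itself, unlike adjacency; the reflexive transitive closure does
not see the difference. -/
theorem gaifman_connected_iff (p : Presentation D A) : (gaifman D).Connected ↔
    Nonempty ι ∧ ∀ a b, Relation.ReflTransGen (Cooc A) a b := by
  rw [SimpleGraph.connected_iff]
  have hreach : ∀ a b, (gaifman D).Reachable (p.e a) (p.e b) ↔
      Relation.ReflTransGen (Cooc A) a b := by
    intro a b
    rw [SimpleGraph.reachable_iff_reflTransGen]
    constructor
    · intro h
      have := Relation.ReflTransGen.lift (r := (gaifman D).Adj) (p := Cooc A) p.e.symm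
        (fun x y hxy => by
          change Cooc A _ _
          rw [p.cooc_iff]
          simpa [Cooc] using hxy.2) _ _ h
      simpa [Function.onFun] using this
    · intro h
      induction h with
      | refl => exact .refl
      | @tail b c _ hbc ih =>
        by_cases hne : b = c
        · exact hne ▸ ih
        · exact ih.tail ⟨fun h => hne (p.e.injective h), p.cooc_iff.1 hbc⟩
  refine ⟨fun ⟨h, ⟨x⟩⟩ => ⟨⟨p.e.symm x⟩, fun a b => (hreach a b).1 (h _ _)⟩,
    fun ⟨⟨x⟩, h⟩ => ⟨fun a b => ?_, ⟨p.e x⟩⟩⟩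
  have := (hreach (p.e.symm a) (p.e.symm b)).2 (h _ _)
  simpa using this

end Presentation

/-- Homomorphisms from a pointed database, in terms of a presentation. -/
def Presentation.homEquiv {F : PointedDatabase S V} {A : Set (Fact S ι)}
    (p : Presentation F.db A) {x : ι} (hx : p.e x = F.pt) (X : PointedDatabase S V) :
    Hom F X ≃ {g : ι → {a : V // a ∈ adom X.db} //
      g x = X.pt ∧ ∀ f ∈ A, Fact.map (fun a => (g a).1) f ∈ X.db} where
  toFun h := ⟨fun a => h.1 (p.e a), by simp only [hx]; exact h.2.1, fun f hf =>
    h.2.2 f.1 (fun i => p.e (f.2 i)) ((p.mem_iff f).1 hf)⟩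
  invFun g := ⟨fun a => g.1 (p.e.symm a), by rw [← hx]; simpa using g.2.1, fun R t ht => by
    refine g.2.2 ⟨R, fun i => p.e.symm (t i)⟩ ((p.mem_iff _).2 ?_)
    simpa [Fact.map, Function.comp_def] using ht⟩
  left_inv h := by ext; simp
  right_inv g := by ext; simp

instance finite_fact [Finite ι] : Finite (Fact S ι) := inferInstanceAs (Finite (Σ _, _))

open scoped Classical in
-- An infinite `V` contains a copy of any finite index type. The covering condition is needed
-- because a database has no values beyond those in its facts.
theorem exists_presentation_of_covered [Infinite V] [Finite ι] (A : Set (Fact S ι))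
    (hA : ∀ a, ∃ f ∈ A, ∃ i, f.2 i = a) (x : ι) :
    ∃ (F : PointedDatabase S V) (p : Presentation F.db A), p.e x = F.pt := by
  let j : ι ↪ V := (Finite.equivFin ι).toEmbedding.trans
    (Fin.valEmbedding.trans (Infinite.natEmbedding V))
  let D : Database S V := (Set.toFinite A).toFinset.image (Fact.map j)
  have hmem : ∀ a, j a ∈ adom D := fun a => by
    obtain ⟨f, hf, i, rfl⟩ := hA a
    exact mem_adom.2 ⟨_, Finset.mem_image_of_mem _ ((Set.Finite.mem_toFinset _).2 hf), i, rfl⟩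
  let e : ι ≃ {a : V // a ∈ adom D} := Equiv.ofBijective (fun a => ⟨j a, hmem a⟩) (by
    constructor
    · intro a b h
      exact j.injective (congrArg Subtype.val h)
    · rintro ⟨y, hy⟩
      obtain ⟨f, hf, i, rfl⟩ := mem_adom.1 hy
      obtain ⟨f', -, rfl⟩ := Finset.mem_image.1 hf
      exact ⟨f'.2 i, rfl⟩)
  have hinj : Function.Injective (Fact.map (S := S) j) := by
    rintro ⟨R, t⟩ ⟨R', t'⟩ h
    obtain rfl : R = R' := congrArg Sigma.fst h
    simp only [Fact.map, Sigma.mk.injEq, heq_eq_eq, true_and] at h ⊢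
    exact j.injective.comp_left h
  refine ⟨⟨D, e x⟩, ⟨e, fun f => ?_⟩, rfl⟩
  change f ∈ A ↔ Fact.map j f ∈ D
  simp [D, hinj.mem_finset_image]

theorem exists_presentation (F : PointedDatabase S V) :
    ∃ (m : ℕ) (A : Set (Fact S (Fin (m + 1)))) (p : Presentation F.db A), p.e 0 = F.pt := by
  classical
  obtain ⟨m, hm⟩ : ∃ m, Fintype.card {a : V // a ∈ adom F.db} = m + 1 :=
    ⟨_, (Nat.succ_pred_eq_of_pos (Fintype.card_pos_iff.2 ⟨F.pt⟩)).symm⟩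
  let e₀ := (Fintype.equivFinOfCardEq hm).symm
  -- The transposition moves the distinguished value to index 0, the place of the free variable.
  let e := (Equiv.swap 0 (e₀.symm F.pt)).trans e₀
  exact ⟨m, {f | Fact.map (fun a => (e a).1) f ∈ F.db}, ⟨e, fun f => Iff.rfl⟩, by simp [e]⟩

/-- A conjunction of relational atoms, value properties of variables and inequalities, with
variables from `ι`. -/
structure Conj (S : Schema.{u}) (V : Type v) (ι : Type) where
  atoms : Set (Fact S ι)
  unary : Set (ι × ValueProperty S V)
  neq : Set (ι × ι)

namespace Conj

/-- Satisfaction of a conjunction. -/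
def Sat (c : Conj S V ι) (D : Database S V) (g : ι → {a : V // a ∈ adom D}) : Prop :=
  (∀ f ∈ c.atoms, Fact.map (fun a => (g a).1) f ∈ D) ∧
    (∀ u ∈ c.unary, (⟨D, g u.1⟩ : PointedDatabase S V) ∈ u.2) ∧ ∀ p ∈ c.neq, g p.1 ≠ g p.2

/-- Every variable occurs in an atom. -/
def Covered (c : Conj S V ι) : Prop := ∀ a, ∃ f ∈ c.atoms, ∃ i, f.2 i = a

/-- The Gaifman graph of the atoms is connected. -/
def Linked (c : Conj S V ι) : Prop := ∀ a b, Relation.ReflTransGen (Cooc c.atoms) a b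

/-- The union of renamed conjunctions, with additional inequalities. -/
def glue {J : Type} {τ : J → Type} (c : ∀ j, Conj S V (τ j)) (ρ : ∀ j, τ j → ι)
    (E : Set (ι × ι)) : Conj S V ι where
  atoms := ⋃ j, Fact.map (ρ j) '' (c j).atoms
  unary := ⋃ j, Prod.map (ρ j) id '' (c j).unary
  neq := E ∪ ⋃ j, Prod.map (ρ j) (ρ j) '' (c j).neq

theorem sat_glue {J : Type} {τ : J → Type} {c : ∀ j, Conj S V (τ j)} {ρ : ∀ j, τ j → ι}
    {E : Set (ι × ι)} {D : Database S V} {g : ι → {a : V // a ∈ adom D}} :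
    (glue c ρ E).Sat D g ↔ (∀ j, (c j).Sat D (g ∘ ρ j)) ∧ ∀ p ∈ E, g p.1 ≠ g p.2 := by
  simp only [Sat, glue, Set.mem_iUnion, Set.mem_image, Set.mem_union]
  constructor
  · rintro ⟨h₁, h₂, h₃⟩
    exact ⟨fun j => ⟨fun f hf => h₁ _ ⟨j, f, hf, rfl⟩, fun u hu => h₂ _ ⟨j, u, hu, rfl⟩,
      fun p hp => h₃ _ (.inr ⟨j, p, hp, rfl⟩)⟩, fun p hp => h₃ p (.inl hp)⟩
  · rintro ⟨h, hE⟩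
    refine ⟨?_, ?_, ?_⟩
    · rintro _ ⟨j, f, hf, rfl⟩
      exact (h j).1 f hf
    · rintro _ ⟨j, u, hu, rfl⟩
      exact (h j).2.1 u hu
    · rintro _ (hp | ⟨j, p, hp, rfl⟩)
      · exact hE _ hp
      · exact (h j).2.2 p hp

/-- A renamed conjunction. -/
def map (c : Conj S V ι) (ρ : ι → κ) : Conj S V κ := glue (fun _ : Unit => c) (fun _ => ρ) ∅

theorem sat_map {c : Conj S V ι} {ρ : ι → κ} {D : Database S V}
    {g : κ → {a : V // a ∈ adom D}} : (c.map ρ).Sat D g ↔ c.Sat D (g ∘ ρ) := by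
  simp [map, sat_glue]

/-- The number of satisfying assignments that send the variable `x` to the distinguished
value. -/
noncomputable def count (c : Conj S V ι) (x : ι) (X : PointedDatabase S V) : ℕ :=
  Nat.card {g : ι → {a : V // a ∈ adom X.db} // g x = X.pt ∧ c.Sat X.db g}

theorem count_pos_iff [Finite ι] {c : Conj S V ι} {x : ι} {X : PointedDatabase S V} :
    0 < c.count x X ↔ ∃ g : ι → {a : V // a ∈ adom X.db}, g x = X.pt ∧ c.Sat X.db g := by
  rw [count, Nat.card_pos_iff, nonempty_subtype]
  exact and_iff_left inferInstance

/-- A conjunction whose value properties satisfy `A`, which is covered and linked if `conn`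
holds, and without inequalities if `plain` holds. -/
structure Ok (A : ValueProperty S V → Prop) (conn plain : Prop) (c : Conj S V ι) : Prop where
  finite : c.unary.Finite
  unary : ∀ u ∈ c.unary, A u.2
  covered : conn → c.Covered
  linked : conn → c.Linked
  plain : plain → c.neq = ∅

variable {A : ValueProperty S V → Prop} {conn plain : Prop}

theorem Covered.glue {J : Type} {τ : J → Type} {c : ∀ j, Conj S V (τ j)} {ρ : ∀ j, τ j → ι}
    {E : Set (ι × ι)} (hc : ∀ j, (c j).Covered) (hρ : ∀ b, ∃ j a, ρ j a = b) :
    (Conj.glue c ρ E).Covered := by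
  intro b
  obtain ⟨j, a, rfl⟩ := hρ b
  obtain ⟨f, hf, i, rfl⟩ := hc j a
  exact ⟨_, Set.mem_iUnion.2 ⟨j, f, hf, rfl⟩, i, rfl⟩

/-- All parts share the variable `b₀`, so any two variables are joined by a path through it. -/
theorem Linked.glue {J : Type} {τ : J → Type} {c : ∀ j, Conj S V (τ j)} {ρ : ∀ j, τ j → ι}
    {E : Set (ι × ι)} (hc : ∀ j, (c j).Linked) (hρ : ∀ b, ∃ j a, ρ j a = b)
    (h₀ : ∃ b, ∀ j, ∃ a, ρ j a = b) : (Conj.glue c ρ E).Linked := by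
  have hlift : ∀ j a b, Relation.ReflTransGen (Cooc (Conj.glue c ρ E).atoms) (ρ j a) (ρ j b) :=
    fun j a b => Relation.ReflTransGen.lift (ρ j) (fun _ _ h => Cooc.map
      (fun f hf => Set.mem_iUnion.2 ⟨j, Set.mem_image_of_mem _ hf⟩) h) _ _ (hc j a b)
  obtain ⟨b₀, h₀⟩ := h₀
  intro a b
  obtain ⟨j, a, rfl⟩ := hρ a
  obtain ⟨k, b, rfl⟩ := hρ b
  obtain ⟨a₀, rfl⟩ := h₀ j
  obtain ⟨a₁, h₁⟩ := h₀ k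
  exact (hlift j a a₀).trans (h₁ ▸ hlift k a₁ b)

theorem Ok.glue {J : Type} [Finite J] {τ : J → Type} {c : ∀ j, Conj S V (τ j)}
    {ρ : ∀ j, τ j → ι} {E : Set (ι × ι)} (hc : ∀ j, (c j).Ok A conn plain)
    (hρ : conn → ∀ b, ∃ j a, ρ j a = b) (h₀ : conn → ∃ b, ∀ j, ∃ a, ρ j a = b)
    (hE : plain → E = ∅) : (Conj.glue c ρ E).Ok A conn plain where
  finite := Set.finite_iUnion fun j => (hc j).finite.image _
  unary := by
    intro u hu
    obtain ⟨j, u', hu', rfl⟩ := Set.mem_iUnion.1 hu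
    exact (hc j).unary u' hu'
  covered h := Covered.glue (fun j => (hc j).covered h) (hρ h)
  linked h := Linked.glue (fun j => (hc j).linked h) (hρ h) (h₀ h)
  plain h := by simp [Conj.glue, hE h, fun j => (hc j).plain h]

end Conj

end Patterns

/-! ### Simple layers and linear combinations of pattern counts -/

section Networks

variable {S : Schema.{u}} {V : Type v} {ι : Type}

/-- On multisets of zeros and ones, the aggregation function returns `wt n`, where `n` is the
number of ones; `wt` tells zero and non-zero counts apart. -/
structure AggSpec (agg : Aggregation) (wt : ℕ → ℝ) : Prop where
  eq_count : ∀ M : Multiset ℝ, (∀ x ∈ M, x = 0 ∨ x = 1) → agg M = wt (M.count 1)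
  zero : wt 0 = 0
  one_le : ∀ n, 1 ≤ n → 1 ≤ wt n

theorem aggSpec_sum : AggSpec sumAgg (fun n => n) where
  eq_count M hM := by
    unfold sumAgg
    induction M using Multiset.induction_on with
    | empty => simp
    | cons a s ih =>
      rw [Multiset.sum_cons, ih fun x hx => hM x (Multiset.mem_cons_of_mem hx)]
      obtain rfl | rfl := hM a (Multiset.mem_cons_self a s)
      · simp
      · simp [add_comm]
  zero := by simp
  one_le n h := by exact_mod_cast h

theorem aggSpec_max : AggSpec maxAgg (fun n => (min n 1 : ℕ)) where
  eq_count M hM := by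
    unfold maxAgg
    by_cases h1 : (1 : ℝ) ∈ M
    · have : IsGreatest {x : ℝ | x ∈ M} 1 :=
        ⟨h1, fun x hx => by obtain rfl | rfl := hM x hx <;> norm_num⟩
      rw [this.csSup_eq, min_eq_right (Multiset.one_le_count_iff_mem.2 h1)]
      simp
    · rw [Multiset.count_eq_zero_of_notMem h1]
      have h0 : ∀ x ∈ M, x = 0 := fun x hx =>
        (hM x hx).resolve_right fun h => h1 (h ▸ hx)
      rcases M.empty_or_exists_mem with rfl | ⟨a, ha⟩
      · simp
      · have : {x : ℝ | x ∈ M} = {0} := by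
          ext x
          exact ⟨fun hx => h0 x hx, fun hx => by
            rw [Set.mem_singleton_iff.1 hx, ← h0 a ha]; exact ha⟩
        simp [this]
  zero := by simp
  one_le n h := by simp [h]

theorem reluStar_of_nonpos {x : ℝ} (h : x ≤ 0) : reluStar x = 0 := by
  simp [reluStar, max_eq_left h]

theorem reluStar_of_one_le {x : ℝ} (h : 1 ≤ x) : reluStar x = 1 := by
  rw [reluStar, max_eq_right (zero_le_one.trans h), min_eq_right h]

open scoped Classical in
-- The argument of ReLU* is 1 minus the number of `k ∈ s` at which `b` fails: it is 1 if there are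
-- none and otherwise at most 0.
theorem reluStar_conjunction {d : ℕ} (s : Finset (Fin d)) (b : Fin d → Prop) (x : Fin d → ℝ)
    (hx : ∀ k, x k = if b k then 1 else 0) :
    reluStar (∑ k, x k * ((if k ∈ s then 1 else 0 : ℚ) : ℝ) + ((1 - s.card : ℚ) : ℝ)) =
      if ∀ k ∈ s, b k then 1 else 0 := by
  have hsum : ∑ k, x k * ((if k ∈ s then 1 else 0 : ℚ) : ℝ) = ((s.filter b).card : ℝ) := by
    simp [hx, apply_ite]
  rw [hsum]
  split_ifs with h
  · rw [Finset.filter_true_of_mem h]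
    exact reluStar_of_one_le (by push_cast; linarith)
  · apply reluStar_of_nonpos
    have hlt : (s.filter b).card < s.card := Finset.card_lt_card (by
      rw [Finset.filter_ssubset]
      push Not at h
      exact h)
    have : ((s.filter b).card : ℝ) + 1 ≤ s.card := by exact_mod_cast hlt
    push_cast
    linarith

theorem Conj.count_eq_card_hom {F : PointedDatabase S V} {c : Conj S V ι}
    (p : Presentation F.db c.atoms) {x : ι} (hx : p.e x = F.pt) (hneq : c.neq = ∅)
    (X : PointedDatabase S V) :
    c.count x X = Nat.card {h : Hom F X //
      ∀ u ∈ c.unary, (⟨X.db, h.1 (p.e u.1)⟩ : PointedDatabase S V) ∈ u.2} := by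
  refine Nat.card_congr (Equiv.symm ?_)
  refine ((p.homEquiv hx X).subtypeEquiv (q := fun g => ∀ u ∈ c.unary,
    (⟨X.db, g.1 u.1⟩ : PointedDatabase S V) ∈ u.2) fun h => Iff.rfl).trans ?_
  refine (Equiv.subtypeSubtypeEquivSubtypeInter _ (fun g : ι → {a : V // a ∈ adom X.db} =>
    ∀ u ∈ c.unary, (⟨X.db, g u.1⟩ : PointedDatabase S V) ∈ u.2)).trans ?_
  exact Equiv.subtypeEquivRight fun g => by simp [Conj.Sat, hneq, and_assoc]

variable {agg : Aggregation} {wt : ℕ → ℝ} {conn : Prop}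

open scoped Classical in
-- The transformation at a value of the pattern is the conjunction of the properties required there,
-- so the product over the pattern is 0 or 1 and tests all of them. `AggSpec` then evaluates the
-- aggregation.
theorem exists_query [Infinite V] (hagg : AggSpec agg wt) {d : ℕ}
    (P : Fin d → ValueProperty S V) [Finite ι] (x : ι) (c : Conj S V ι) (hcov : c.Covered)
    (hlink : conn → c.Linked) (hneq : c.neq = ∅) (hun : ∀ u ∈ c.unary, u.2 ∈ Set.range P) :
    ∃ q : HomQuery S V d 1, q.agg = agg ∧ (conn → (gaifman q.F.db).Connected) ∧
      (∀ a, IsSimpleTrans (q.trans a)) ∧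
      ∀ D lam, (∀ y k, lam y k = if (⟨D, y⟩ : PointedDatabase S V) ∈ P k then 1 else 0) →
        ∀ w, q.eval D lam w 0 = wt (c.count x ⟨D, w⟩) := by
  obtain ⟨F, p, hp⟩ := exists_presentation_of_covered (V := V) c.atoms hcov x
  let s : ι → Finset (Fin d) := fun a => Finset.univ.filter fun k => (a, P k) ∈ c.unary
  refine ⟨⟨one_pos, F, fun a y _ => reluStar (∑ k, y k *
    ((if k ∈ s (p.e.symm a) then 1 else 0 : ℚ) : ℝ) + ((1 - (s (p.e.symm a)).card : ℚ) : ℝ)), agg⟩,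
    rfl, fun h => p.gaifman_connected_iff.2 ⟨⟨x⟩, hlink h⟩, fun a =>
      ⟨fun k _ => if k ∈ s (p.e.symm a) then 1 else 0, fun _ => 1 - (s (p.e.symm a)).card,
        fun _ _ => rfl⟩, ?_⟩
  intro D lam hlam w
  have hprod : ∀ h : Hom F ⟨D, w⟩, ∏ a, reluStar (∑ k, lam (h.1 a) k *
      ((if k ∈ s (p.e.symm a) then 1 else 0 : ℚ) : ℝ) + ((1 - (s (p.e.symm a)).card : ℚ) : ℝ)) =
      if ∀ u ∈ c.unary, (⟨D, h.1 (p.e u.1)⟩ : PointedDatabase S V) ∈ u.2 then 1 else 0 := by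
    intro h
    have : ∀ a, reluStar (∑ k, lam (h.1 a) k * ((if k ∈ s (p.e.symm a) then 1 else 0 : ℚ) : ℝ) +
        ((1 - (s (p.e.symm a)).card : ℚ) : ℝ)) =
        if ∀ k ∈ s (p.e.symm a), (⟨D, h.1 a⟩ : PointedDatabase S V) ∈ P k then 1 else 0 :=
      fun a => by convert reluStar_conjunction _ _ _ (hlam (h.1 a))
    by_cases H : ∀ u ∈ c.unary, (⟨D, h.1 (p.e u.1)⟩ : PointedDatabase S V) ∈ u.2
    · rw [if_pos H]
      refine Finset.prod_eq_one fun a _ => (this a).trans (if_pos fun k hk => ?_)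
      simpa using H _ (Finset.mem_filter.1 hk).2
    · rw [if_neg H]
      push Not at H
      obtain ⟨u, hu, hu'⟩ := H
      obtain ⟨k, hk⟩ := hun u hu
      refine Finset.prod_eq_zero (Finset.mem_univ (p.e u.1)) ((this _).trans (if_neg fun H => ?_))
      have := H k (by simpa [s, hk] using hu)
      rw [hk] at this
      exact hu' this
  change agg (Multiset.map _ _) = _
  rw [Multiset.map_congr rfl fun h _ => hprod h, hagg.eq_count]
  · congr 1
    rw [c.count_eq_card_hom p hp hneq, Multiset.count_map, Nat.card_eq_fintype_card,
      Fintype.card_subtype, Finset.card_def, Finset.filter_val]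
    congr 1
    refine Multiset.filter_congr fun h _ => ?_
    by_cases hh : ∀ u ∈ c.unary, (⟨D, h.1 (p.e u.1)⟩ : PointedDatabase S V) ∈ u.2
    · exact iff_of_true (if_pos hh).symm hh
    · exact iff_of_false (by rw [if_neg hh]; exact one_ne_zero) hh
  · intro y hy
    obtain ⟨h, -, rfl⟩ := Multiset.mem_map.1 hy
    split_ifs <;> simp

/-- The counting functions of covered conjunctions (linked if `conn` holds) without inequalities
over the value properties in `𝒜`. -/
def countFns (wt : ℕ → ℝ) (conn : Prop) (𝒜 : Set (ValueProperty S V)) :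
    Set (PointedDatabase S V → ℝ) :=
  {f | ∃ (ι : Type) (_ : Finite ι) (x : ι) (c : Conj S V ι), c.Covered ∧ (conn → c.Linked) ∧
    c.neq = ∅ ∧ (∀ u ∈ c.unary, u.2 ∈ 𝒜) ∧ f = fun X => wt (c.count x X)}

theorem countFns_mono {𝒜 ℬ : Set (ValueProperty S V)} (h : 𝒜 ⊆ ℬ) :
    countFns wt conn 𝒜 ⊆ countFns wt conn ℬ := by
  rintro f ⟨ι, hι, x, c, h₁, h₂, h₃, h₄, rfl⟩
  exact ⟨ι, hι, x, c, h₁, h₂, h₃, fun u hu => h (h₄ u hu), rfl⟩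

/-- Simple layers with the aggregation function `agg`, connected if `conn` holds. -/
def Layer.Admissible (agg : Aggregation) (conn : Prop) {d d' : ℕ} (L : Layer S V d d') : Prop :=
  (∀ i, (L.query i).agg = agg) ∧ (conn → ∀ i, (gaifman (L.query i).F.db).Connected) ∧
    IsSimpleCom L.com ∧ ∀ i a, IsSimpleTrans ((L.query i).trans a)

open scoped Classical in
theorem exists_layer [Infinite V] (hagg : AggSpec agg wt) {d d' : ℕ}
    (P : Fin d → ValueProperty S V) (b : Fin d' → ℚ) (g : Fin d' → PointedDatabase S V → ℝ)
    (hg : ∀ k, g k ∈ Submodule.span ℚ (countFns wt conn (Set.range P))) :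
    ∃ L : Layer S V d d', L.Admissible agg conn ∧
      ∀ D lam, (∀ y k, lam y k = if (⟨D, y⟩ : PointedDatabase S V) ∈ P k then 1 else 0) →
        ∀ w k, L.apply D lam w k = reluStar (g k ⟨D, w⟩ + b k) := by
  choose n q s hs using fun k => Submodule.mem_span_set'.1 (hg k)
  have hq : ∀ k i, ∃ Q : HomQuery S V d 1, Q.agg = agg ∧
      (conn → (gaifman Q.F.db).Connected) ∧ (∀ a, IsSimpleTrans (Q.trans a)) ∧
      ∀ D lam, (∀ y k, lam y k = if (⟨D, y⟩ : PointedDatabase S V) ∈ P k then 1 else 0) →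
        ∀ w, Q.eval D lam w 0 = (s k i).1 ⟨D, w⟩ := by
    intro k i
    obtain ⟨ι, _, x, c, h₁, h₂, h₃, h₄, h₅⟩ := (s k i).2
    rw [h₅]
    exact exists_query hagg P x c h₁ h₂ h₃ h₄
  choose Q hQa hQc hQt hQe using hq
  -- One query for each term of each linear combination; the matrices give it weight 0 in all output
  -- components but its own.
  let e := Fintype.equivFin (Σ k : Fin d', Fin (n k))
  refine ⟨⟨_, fun _ => 1, fun i => Q (e.symm i).1 (e.symm i).2, fun x k =>
    reluStar (∑ i, ∑ j, x i j *
      ((if (e.symm i).1 = k then q (e.symm i).1 (e.symm i).2 else 0 : ℚ) : ℝ) + (b k : ℝ))⟩,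
    ⟨fun i => hQa _ _, fun h i => hQc _ _ h, ⟨fun i _ k =>
      if (e.symm i).1 = k then q (e.symm i).1 (e.symm i).2 else 0, b, fun _ _ => rfl⟩,
      fun i => hQt _ _⟩, ?_⟩
  intro D lam hlam w k
  simp only [Layer.apply]
  congr 2
  simp only [Finset.univ_unique, Fin.default_eq_zero, Finset.sum_singleton]
  rw [e.symm.sum_comp fun j => (Q j.1 j.2).eval D lam w 0 *
    ((if j.1 = k then q j.1 j.2 else 0 : ℚ) : ℝ), Fintype.sum_sigma, Finset.sum_eq_single k]
  · simp only [hQe _ _ D lam hlam, ← hs, if_true]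
    simp [Finset.sum_apply, Rat.smul_def, mul_comm]
  · intro k' _ hk'
    simp [hk']
  · simp

/-! ### Networks that compute characteristic functions of value properties -/

theorem Layers.All.mono {P Q : ∀ {d d' : ℕ}, Layer S V d d' → Prop}
    (h : ∀ {d d' : ℕ} (L : Layer S V d d'), P L → Q L) {d : ℕ} {N : Layers S V d}
    (hN : N.All P) : N.All Q := by
  induction N with
  | nil => trivial
  | snoc N L ih => exact ⟨ih hN.1, h L hN.2⟩

open scoped Classical in
/-- The sequence of layers is admissible and computes the characteristic functions of the
value properties `P`. -/
def Layers.Computes (agg : Aggregation) (conn : Prop) {d : ℕ} (N : Layers S V d)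
    (P : Fin d → ValueProperty S V) : Prop :=
  (N.All fun L => L.Admissible agg conn) ∧
    ∀ D w k, N.embed D w k = if (⟨D, w⟩ : PointedDatabase S V) ∈ P k then 1 else 0

/-- Every admissible network that computes value properties can be extended to one that
computes, in addition, the value property `Q`. -/
def Adjoinable (agg : Aggregation) (conn : Prop) (Q : ValueProperty S V) : Prop :=
  ∀ (d : ℕ) (N : Layers S V d) (P : Fin d → ValueProperty S V), N.Computes agg conn P →
    ∃ (d' : ℕ) (N' : Layers S V d') (P' : Fin d' → ValueProperty S V),
      N'.Computes agg conn P' ∧ Set.range P ⊆ Set.range P' ∧ Q ∈ Set.range P'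

theorem exists_computes_of_finite {𝒜 : Set (ValueProperty S V)} (hfin : 𝒜.Finite)
    (h𝒜 : ∀ P ∈ 𝒜, Adjoinable agg conn P) {d : ℕ} {N : Layers S V d}
    {P : Fin d → ValueProperty S V} (hN : N.Computes agg conn P) :
    ∃ (d' : ℕ) (N' : Layers S V d') (P' : Fin d' → ValueProperty S V),
      N'.Computes agg conn P' ∧ Set.range P ⊆ Set.range P' ∧ 𝒜 ⊆ Set.range P' := by
  induction 𝒜, hfin using Set.Finite.induction_on with
  | empty => exact ⟨d, N, P, hN, subset_rfl, Set.empty_subset _⟩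
  | @insert Q 𝒜 _ _ ih =>
    obtain ⟨d₁, N₁, P₁, h₁, h₂, h₃⟩ := ih fun R hR => h𝒜 R (Set.mem_insert_of_mem _ hR)
    obtain ⟨d₂, N₂, P₂, h₄, h₅, h₆⟩ := h𝒜 Q (Set.mem_insert _ _) d₁ N₁ P₁ h₁
    exact ⟨d₂, N₂, P₂, h₄, h₂.trans h₅, Set.insert_subset h₆ (h₃.trans h₅)⟩

/-- The conjunction that consists of an atom with distinct variables and of a value property. -/
def factConj (R : S.Rel) (i : Fin (S.ar R)) (P : ValueProperty S V) : Conj S V (Fin (S.ar R)) where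
  atoms := {⟨R, id⟩}
  unary := {(i, P)}
  neq := ∅

theorem factConj_covered (R : S.Rel) (i : Fin (S.ar R)) (P : ValueProperty S V) :
    (factConj R i P).Covered := fun a => ⟨_, rfl, a, rfl⟩

theorem factConj_linked (R : S.Rel) (i : Fin (S.ar R)) (P : ValueProperty S V) :
    (factConj R i P).Linked := fun a b => .single ⟨_, rfl, ⟨a, rfl⟩, b, rfl⟩

theorem factConj_count_pos_iff (R : S.Rel) (i : Fin (S.ar R)) (P : ValueProperty S V)
    (X : PointedDatabase S V) : 0 < (factConj R i P).count i X ↔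
      X ∈ P ∧ ∃ f ∈ X.db, f.1 = R ∧ ∃ h : f.1 = R, f.2 (h ▸ i) = X.pt.1 := by
  rw [Conj.count_pos_iff]
  constructor
  · rintro ⟨g, hg, hs⟩
    refine ⟨?_, _, hs.1 _ rfl, rfl, rfl, ?_⟩
    · have := hs.2.1 _ rfl
      simpa [hg] using this
    · exact congrArg Subtype.val hg
  · rintro ⟨hP, ⟨R', t⟩, hf, rfl, h, hi⟩
    refine ⟨fun j => ⟨t j, mem_adom.2 ⟨_, hf, j, rfl⟩⟩, Subtype.ext hi, ?_, ?_, by simp [factConj]⟩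
    · rintro _ rfl
      exact hf
    · rintro _ rfl
      have : (⟨t i, mem_adom.2 ⟨_, hf, i, rfl⟩⟩ : {a : V // a ∈ adom X.db}) = X.pt :=
        Subtype.ext hi
      simpa [this] using hP

/-- A counting function that is zero outside `P` and at least one on `P`. -/
noncomputable def keepFn (wt : ℕ → ℝ) (P : ValueProperty S V) : PointedDatabase S V → ℝ :=
  letI := Fintype.ofFinite S.Rel
  ∑ p : Σ R : S.Rel, Fin (S.ar R), fun X => wt ((factConj p.1 p.2 P).count p.2 X)

theorem keepFn_mem {𝒜 : Set (ValueProperty S V)} {P : ValueProperty S V} (hP : P ∈ 𝒜) :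
    keepFn wt P ∈ Submodule.span ℚ (countFns wt conn 𝒜) := by
  refine Submodule.sum_mem _ fun p _ => Submodule.subset_span ?_
  refine ⟨_, inferInstance, p.2, factConj p.1 p.2 P, factConj_covered _ _ _,
    fun _ => factConj_linked _ _ _, rfl, ?_, rfl⟩
  rintro _ rfl
  exact hP

theorem AggSpec.nonneg (hagg : AggSpec agg wt) (n : ℕ) : 0 ≤ wt n := by
  rcases n.eq_zero_or_pos with rfl | h
  · exact hagg.zero.ge
  · exact zero_le_one.trans (hagg.one_le n h)

theorem keepFn_of_notMem (hagg : AggSpec agg wt) {P : ValueProperty S V}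
    {X : PointedDatabase S V} (hX : X ∉ P) : keepFn wt P X = 0 := by
  simp only [keepFn, Finset.sum_apply]
  refine Finset.sum_eq_zero fun p _ => ?_
  have : (factConj p.1 p.2 P).count p.2 X = 0 := by
    by_contra h
    exact hX ((factConj_count_pos_iff _ _ _ _).1 (Nat.pos_of_ne_zero h)).1
  rw [this, hagg.zero]

/-- A value of the active domain occurs in some fact at some position, and the sum ranges over all
symbols and positions. No single pattern would do: it must contain a fact, and a given value need
not match it. -/
theorem one_le_keepFn (hagg : AggSpec agg wt) {P : ValueProperty S V}
    {X : PointedDatabase S V} (hX : X ∈ P) : 1 ≤ keepFn wt P X := by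
  let _ := Fintype.ofFinite S.Rel
  obtain ⟨f, hf, i, hi⟩ := mem_adom.1 X.pt.2
  simp only [keepFn, Finset.sum_apply]
  refine le_trans (hagg.one_le _ ((factConj_count_pos_iff f.1 i P X).2
    ⟨hX, f, hf, rfl, rfl, hi⟩)) ?_
  exact Finset.single_le_sum (f := fun p : Σ R : S.Rel, Fin (S.ar R) =>
    wt ((factConj p.1 p.2 P).count p.2 X)) (fun p _ => hagg.nonneg _)
    (Finset.mem_univ (⟨f.1, i⟩ : Σ R : S.Rel, Fin (S.ar R)))

theorem keepFn_nonneg (hagg : AggSpec agg wt) (P : ValueProperty S V)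
    (X : PointedDatabase S V) : 0 ≤ keepFn wt P X := by
  by_cases h : X ∈ P
  · exact zero_le_one.trans (one_le_keepFn hagg h)
  · exact (keepFn_of_notMem hagg h).ge

open scoped Classical in
-- A layer sees only the embedding before it, so the new layer has to recompute all old components
-- along with `Q`; `keepFn` does this, with bias 0.
theorem adjoinable_of_span [Infinite V] (hagg : AggSpec agg wt) {𝒜 : Set (ValueProperty S V)}
    (hfin : 𝒜.Finite) (h𝒜 : ∀ P ∈ 𝒜, Adjoinable agg conn P) {g : PointedDatabase S V → ℝ}
    (hg : g ∈ Submodule.span ℚ (countFns wt conn 𝒜)) (b : ℚ) {Q : ValueProperty S V}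
    (hQ : ∀ X, reluStar (g X + b) = if X ∈ Q then 1 else 0) : Adjoinable agg conn Q := by
  intro d N P hN
  obtain ⟨d₁, N₁, P₁, h₁, h₂, h₃⟩ := exists_computes_of_finite hfin h𝒜 hN
  obtain ⟨L, hL, hL'⟩ := exists_layer (conn := conn) hagg P₁ (Fin.snoc (fun _ => 0) b)
    (Fin.snoc (α := fun _ => PointedDatabase S V → ℝ) (fun k => keepFn wt (P₁ k)) g) (by
      intro k
      induction k using Fin.lastCases with
      | last => simpa using Submodule.span_mono (countFns_mono h₃) hg
      | cast k => simpa using keepFn_mem (Set.mem_range_self k))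
  refine ⟨d₁ + 1, .snoc N₁ L, Fin.snoc (α := fun _ => ValueProperty S V) P₁ Q,
    ⟨⟨h₁.1, hL⟩, fun D w k => ?_⟩, ?_, ⟨Fin.last _, by simp⟩⟩
  · change L.apply D (N₁.embed D) w k = _
    rw [hL' D _ (h₁.2 D)]
    induction k using Fin.lastCases with
    | last => simpa using hQ ⟨D, w⟩
    | cast k =>
      simp only [Fin.snoc_castSucc, Rat.cast_zero, add_zero]
      split_ifs with h
      · exact reluStar_of_one_le (one_le_keepFn hagg h)
      · exact reluStar_of_nonpos (keepFn_of_notMem hagg h).le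
  · refine h₂.trans ?_
    rintro _ ⟨k, rfl⟩
    exact ⟨k.castSucc, by simp⟩

/-- The characteristic function of the complement is ReLU* of `1 - keepFn wt P`. -/
theorem Adjoinable.compl [Infinite V] (hagg : AggSpec agg wt) {P : ValueProperty S V}
    (hP : Adjoinable agg conn P) : Adjoinable agg conn Pᶜ := by
  classical
  refine adjoinable_of_span hagg (Set.finite_singleton P) (by simpa using hP)
    (Submodule.neg_mem _ (keepFn_mem (Set.mem_singleton P))) 1 fun X => ?_
  by_cases h : X ∈ P
  · rw [if_neg (by simpa using h)]
    exact reluStar_of_nonpos (by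
      have := one_le_keepFn hagg h
      simp only [Pi.neg_apply, Rat.cast_one]
      linarith)
  · rw [if_pos (by simpa using h)]
    exact reluStar_of_one_le (by simp [keepFn_of_notMem hagg h])

theorem Adjoinable.iUnion [Infinite V] (hagg : AggSpec agg wt) {J : Type*} [Finite J]
    {P : J → ValueProperty S V} (hP : ∀ j, Adjoinable agg conn (P j)) :
    Adjoinable agg conn (⋃ j, P j) := by
  classical
  have := Fintype.ofFinite J
  refine adjoinable_of_span (g := ∑ j, keepFn wt (P j)) hagg (Set.finite_range P)
    (by simpa using hP) (Submodule.sum_mem _ fun j _ => keepFn_mem ⟨j, rfl⟩) 0 fun X => ?_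
  rw [Rat.cast_zero, add_zero, Finset.sum_apply]
  split_ifs with h
  · obtain ⟨j, hj⟩ := Set.mem_iUnion.1 h
    exact reluStar_of_one_le ((one_le_keepFn hagg hj).trans (Finset.single_le_sum
      (f := fun j => keepFn wt (P j) X) (fun j _ => keepFn_nonneg hagg _ X) (Finset.mem_univ j)))
  · refine reluStar_of_nonpos (Finset.sum_eq_zero fun j _ => keepFn_of_notMem hagg fun hj => ?_).le
    exact h (Set.mem_iUnion.2 ⟨j, hj⟩)

theorem Adjoinable.union [Infinite V] (hagg : AggSpec agg wt) {P Q : ValueProperty S V}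
    (hP : Adjoinable agg conn P) (hQ : Adjoinable agg conn Q) : Adjoinable agg conn (P ∪ Q) := by
  rw [Set.union_eq_iUnion]
  exact Adjoinable.iUnion hagg fun b => by cases b <;> assumption

/-- Eliminating an inequality: the assignments that violate it are the assignments for the
conjunction in which `b` is replaced by `a`. -/
theorem count_insert_neq [Finite ι] {c : Conj S V ι} {a b : ι} (hab : a ≠ b) (x : ι)
    (X : PointedDatabase S V) (E : Set (ι × ι)) (hE : c.neq = insert (a, b) E)
    [DecidableEq ι] :
    ({c with neq := E} : Conj S V ι).count x X = c.count x X +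
      (({c with neq := E} : Conj S V ι).map fun y => if h : y = b then (⟨a, hab⟩ : {y // y ≠ b})
        else ⟨y, h⟩).count (if h : x = b then (⟨a, hab⟩ : {y // y ≠ b}) else ⟨x, h⟩) X := by
  classical
  set ρ : ι → {y // y ≠ b} := fun y => if h : y = b then ⟨a, hab⟩ else ⟨y, h⟩ with hρ
  have hsat : ∀ g : ι → {a : V // a ∈ adom X.db}, c.Sat X.db g ↔
      ({c with neq := E} : Conj S V ι).Sat X.db g ∧ g a ≠ g b := by
    intro g
    simp only [Conj.Sat, hE, Set.mem_insert_iff, forall_eq_or_imp]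
    tauto
  have hext : ∀ g : {y // y ≠ b} → {a : V // a ∈ adom X.db}, (g ∘ ρ) a = (g ∘ ρ) b := by
    intro g
    simp [hρ, hab]
  have hres : ∀ g : ι → {a : V // a ∈ adom X.db}, g a = g b →
      (fun y : {y // y ≠ b} => g y.1) ∘ ρ = g := by
    intro g hg
    funext y
    by_cases hy : y = b
    · simp [hρ, hy, hg]
    · simp [hρ, hy]
  have hρ' : ∀ y : {y // y ≠ b}, ρ y.1 = y := by
    rintro ⟨y, hy⟩
    simp [hρ, hy]
  change _ = _ + Conj.count _ (ρ x) X
  simp only [Conj.count]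
  rw [← Nat.card_sum]
  refine Nat.card_congr ?_
  -- The assignments for the weakened conjunction split by whether they separate `a` and `b`; those
  -- that do not are the ones that factor through `ρ`.
  refine (Equiv.sumCompl fun g : {g : ι → {a : V // a ∈ adom X.db} //
    g x = X.pt ∧ ({c with neq := E} : Conj S V ι).Sat X.db g} => g.1 a ≠ g.1 b).symm.trans
    (Equiv.sumCongr ?_ ?_)
  · refine (Equiv.subtypeSubtypeEquivSubtypeInter _ fun g : ι → {a : V // a ∈ adom X.db} =>
      g a ≠ g b).trans (Equiv.subtypeEquivRight fun g => ?_)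
    rw [hsat, and_assoc]
  · refine ⟨fun g => ⟨fun y => g.1.1 y.1, ?_⟩, fun g => ⟨⟨g.1 ∘ ρ, ?_⟩, ?_⟩, ?_, ?_⟩
    · have hg := hres g.1.1 (not_not.1 g.2)
      refine ⟨?_, ?_⟩
      · exact (congrFun hg x).trans g.1.2.1
      · rw [Conj.sat_map, hg]
        exact g.1.2.2
    · exact ⟨g.2.1, Conj.sat_map.1 g.2.2⟩
    · exact not_not.2 (hext g.1)
    · intro g
      exact Subtype.ext (Subtype.ext (hres g.1.1 (not_not.1 g.2)))
    · intro g
      refine Subtype.ext (funext fun y => ?_)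
      simp [hρ']

end Networks

/-! ### Elimination of inequalities and existential normal forms -/

section NormalForms

variable {S : Schema.{u}} {V : Type v} {ι : Type} {agg : Aggregation} {wt : ℕ → ℝ}
  {conn plain : Prop}

/-- Induction on the number of inequalities. Each elimination step is a subtraction of counts, so
the aggregation has to return the exact count; this is why max is confined to conjunctions without
inequalities (`plain`). -/
theorem count_mem_span {𝒜 : Set (ValueProperty S V)} (n : ℕ) : ∀ {ι : Type} [Finite ι] (x : ι)
    (c : Conj S V ι), c.Covered → (conn → c.Linked) → (∀ u ∈ c.unary, u.2 ∈ 𝒜) →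
    c.neq.ncard ≤ n → (fun X => (c.count x X : ℝ)) ∈
      Submodule.span ℚ (countFns (fun n => (n : ℝ)) conn 𝒜) := by
  classical
  induction n with
  | zero =>
    intro ι _ x c h₁ h₂ h₃ hn
    exact Submodule.subset_span ⟨ι, inferInstance, x, c, h₁, h₂,
      (Set.ncard_eq_zero (Set.toFinite _)).1 (Nat.le_zero.1 hn), h₃, rfl⟩
  | succ n ih =>
    intro ι _ x c h₁ h₂ h₃ hn
    rcases c.neq.eq_empty_or_nonempty with h₀ | ⟨⟨a, b⟩, hab⟩
    · exact Submodule.subset_span ⟨ι, inferInstance, x, c, h₁, h₂, h₀, h₃, rfl⟩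
    by_cases hne : a = b
    · have : (fun X => (c.count x X : ℝ)) = 0 := by
        funext X
        have : c.count x X = 0 := by
          by_contra h
          obtain ⟨g, -, hg⟩ := Conj.count_pos_iff.1 (Nat.pos_of_ne_zero h)
          exact hg.2.2 _ hab (congrArg g hne)
        simp [this]
      rw [this]
      exact Submodule.zero_mem _
    have hE : c.neq = insert (a, b) (c.neq \ {(a, b)}) := by simp [Set.insert_eq_of_mem hab]
    have hcard : (c.neq \ {(a, b)}).ncard ≤ n := by
      have := Set.ncard_sdiff_singleton_lt_of_mem hab (Set.toFinite _)
      lia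
    have hsurj : ∀ y : {y // y ≠ b}, ∃ (_ : Unit) (z : ι),
        (if h : z = b then (⟨a, hne⟩ : {y // y ≠ b}) else ⟨z, h⟩) = y :=
      fun y => ⟨(), y.1, by simp [y.2]⟩
    -- Dropping the inequality, minus identifying `b` with `a`. Identification is a surjective
    -- renaming, so it keeps the pattern covered and linked.
    have key := Submodule.sub_mem _
      (ih x ({c with neq := c.neq \ {(a, b)}} : Conj S V ι) h₁ h₂ h₃ hcard)
      (ih (if h : x = b then (⟨a, hne⟩ : {y // y ≠ b}) else ⟨x, h⟩)
        (({c with neq := c.neq \ {(a, b)}} : Conj S V ι).map fun y =>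
          if h : y = b then (⟨a, hne⟩ : {y // y ≠ b}) else ⟨y, h⟩)
        (Conj.Covered.glue (fun _ => h₁) hsurj)
        (fun h => Conj.Linked.glue (fun _ => h₂ h) hsurj
          ⟨⟨a, hne⟩, fun _ => ⟨a, by simp [hne]⟩⟩)
        (by
          intro u hu
          obtain ⟨j, u', hu', rfl⟩ := Set.mem_iUnion.1 hu
          exact h₃ u' hu')
        (by
          simp only [Conj.map, Conj.glue, Set.empty_union, Set.iUnion_const]
          exact (Set.ncard_image_le (Set.toFinite _)).trans hcard))
    refine (congrArg (· ∈ _) ?_).mp key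
    funext X
    simp [Pi.sub_apply, count_insert_neq hne x X _ hE]

/-- Since `wt` is 0 at 0 and at least 1 elsewhere, ReLU* of the weighted count is already the
characteristic function. -/
theorem adjoinable_of_covered [Infinite V] (hagg : AggSpec agg wt)
    (hwt : ¬ plain → wt = fun n : ℕ => (n : ℝ)) [Finite ι] (x : ι) {c : Conj S V ι}
    (hc : c.Ok (Adjoinable agg conn) conn plain) (hcov : c.Covered) :
    Adjoinable agg conn {X | ∃ g, g x = X.pt ∧ c.Sat X.db g} := by
  classical
  refine adjoinable_of_span (g := fun X => wt (c.count x X)) (𝒜 := Prod.snd '' c.unary) hagg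
    (hc.finite.image _) ?_ ?_ 0 fun X => ?_
  · rintro _ ⟨u, hu, rfl⟩
    exact hc.unary u hu
  · by_cases hp : plain
    · exact Submodule.subset_span ⟨ι, inferInstance, x, c, hcov, hc.linked, hc.plain hp,
        fun u hu => ⟨u, hu, rfl⟩, rfl⟩
    · rw [hwt hp]
      exact count_mem_span _ x c hcov hc.linked (fun u hu => ⟨u, hu, rfl⟩) le_rfl
  · rw [Rat.cast_zero, add_zero]
    by_cases h : X ∈ {X | ∃ g, g x = X.pt ∧ c.Sat X.db g}
    · rw [if_pos h]
      exact reluStar_of_one_le (hagg.one_le _ (Conj.count_pos_iff.2 h))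
    · rw [if_neg h]
      refine reluStar_of_nonpos ?_
      rw [Nat.eq_zero_of_not_pos fun h' => h (Conj.count_pos_iff.1 h'), hagg.zero]

/-- Without connectedness a variable may occur in no atom, while patterns have no isolated values.
But every active value occurs in a fact, so the property is a finite union over guesses of a symbol
and a position for each variable. -/
theorem adjoinable_of_conj [Infinite V] (hagg : AggSpec agg wt)
    (hwt : ¬ plain → wt = fun n : ℕ => (n : ℝ)) [Finite ι] (x : ι) {c : Conj S V ι}
    (hc : c.Ok (Adjoinable agg conn) conn plain) :
    Adjoinable agg conn {X | ∃ g, g x = X.pt ∧ c.Sat X.db g} := by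
  by_cases hconn : conn
  · exact adjoinable_of_covered hagg hwt x hc (hc.covered hconn)
  -- The guess `s` adds for each `a` an atom on its own variables `⟨a, i⟩`; the old variable `a`
  -- becomes the one at the guessed position.
  let c' : ∀ s : ι → (Σ R : S.Rel, Fin (S.ar R)), Conj S V (Σ a, Fin (S.ar (s a).1)) := fun s =>
    { c.map fun a => ⟨a, (s a).2⟩ with
      atoms := (c.map fun a => (⟨a, (s a).2⟩ : Σ a, Fin (S.ar (s a).1))).atoms ∪
        Set.range fun a => ⟨(s a).1, fun i => ⟨a, i⟩⟩ }
  have hsat : ∀ s D (g : (Σ a, Fin (S.ar (s a).1)) → {a : V // a ∈ adom D}), (c' s).Sat D g ↔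
      c.Sat D (fun a => g ⟨a, (s a).2⟩) ∧
        ∀ a, (⟨(s a).1, fun i => (g ⟨a, i⟩).1⟩ : Fact S V) ∈ D := by
    intro s D g
    rw [show c.Sat D (fun a => g ⟨a, (s a).2⟩) ↔ (c.map fun a => ⟨a, (s a).2⟩).Sat D g from
      Conj.sat_map.symm]
    constructor
    · rintro ⟨h₁, h₂, h₃⟩
      exact ⟨⟨fun f hf => h₁ f (.inl hf), h₂, h₃⟩, fun a => h₁ _ (.inr ⟨a, rfl⟩)⟩
    · rintro ⟨⟨h₁, h₂, h₃⟩, h₄⟩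
      refine ⟨?_, h₂, h₃⟩
      rintro f (hf | ⟨a, rfl⟩)
      · exact h₁ f hf
      · exact h₄ a
  have hok : ∀ s, (c' s).Ok (Adjoinable agg conn) conn plain := by
    intro s
    have h := Conj.Ok.glue (J := Unit) (c := fun _ => c)
      (ρ := fun _ a => (⟨a, (s a).2⟩ : Σ a, Fin (S.ar (s a).1))) (E := ∅) (fun _ => hc)
      (fun h => absurd h hconn) (fun h => absurd h hconn) (fun _ => rfl)
    exact ⟨h.finite, h.unary, fun h => absurd h hconn, fun h => absurd h hconn, h.plain⟩
  have := Adjoinable.iUnion hagg fun s => adjoinable_of_covered hagg hwt ⟨x, (s x).2⟩ (hok s)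
    fun ⟨a, i⟩ => ⟨_, .inr ⟨a, rfl⟩, i, rfl⟩
  convert this using 1
  ext X
  simp only [Set.mem_iUnion, Set.mem_ofPred_eq, hsat]
  constructor
  · rintro ⟨g, hg, hs⟩
    choose f hf i hi using fun a => mem_adom.1 (g a).2
    have heq : (fun a => (⟨(f a).2 (i a), mem_adom.2 ⟨_, hf a, i a, rfl⟩⟩ :
        {a : V // a ∈ adom X.db})) = g := funext fun a => Subtype.ext (hi a)
    refine ⟨fun a => ⟨(f a).1, i a⟩,
      fun p => ⟨(f p.1).2 p.2, mem_adom.2 ⟨_, hf p.1, p.2, rfl⟩⟩, ?_, ?_, hf⟩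
    · exact (congrFun heq x).trans hg
    · simpa only [heq] using hs
  · rintro ⟨s, g, hg, hs, -⟩
    exact ⟨_, hg, hs⟩

/-- The relation `Q` on assignments to the variables in `α` is defined by a finite disjunction
of existentially quantified conjunctions over value properties that satisfy `A`. -/
def HasNormalForm (A : ValueProperty S V → Prop) (conn plain : Prop) {α : Type}
    (Q : ∀ D : Database S V, (α → {a : V // a ∈ adom D}) → Prop) : Prop :=
  ∃ (I : Type) (_ : Finite I) (κ : I → Type) (_ : ∀ i, Finite (κ i))
    (c : ∀ i, Conj S V (α ⊕ κ i)), (∀ i, (c i).Ok A conn plain) ∧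
      ∀ D e, Q D e ↔ ∃ i, ∃ z : κ i → {a : V // a ∈ adom D}, (c i).Sat D (Sum.elim e z)

namespace HasNormalForm

variable {A : ValueProperty S V → Prop} {α β : Type}

theorem of_conj (hα : conn → Nonempty α) {c : Conj S V α} (hc : c.Ok A conn plain) :
    HasNormalForm A conn plain fun D e => c.Sat D e := by
  refine ⟨Unit, inferInstance, fun _ => Empty, fun _ => inferInstance,
    fun _ => c.map Sum.inl, fun _ => Conj.Ok.glue (fun _ => hc) ?_
    (fun h => ⟨Sum.inl (hα h).some, fun _ => ⟨_, rfl⟩⟩) fun _ => rfl, ?_⟩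
  · rintro - (a | ⟨⟨⟩⟩)
    exact ⟨(), a, rfl⟩
  · intro D e
    simp [Conj.sat_map]

theorem exists_of_forall {J : Type} [Finite J]
    {Q : J → ∀ D : Database S V, (α → {a : V // a ∈ adom D}) → Prop}
    (hQ : ∀ j, HasNormalForm A conn plain (Q j)) :
    HasNormalForm A conn plain fun D e => ∃ j, Q j D e := by
  choose I hI κ hκ c hc hs using hQ
  refine ⟨Σ j, I j, inferInstance, fun p => κ p.1 p.2, fun p => hκ p.1 p.2,
    fun p => c p.1 p.2, fun p => hc p.1 p.2, fun D e => ?_⟩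
  simp [hs, Sigma.exists]

theorem forall_of_forall (hconn : ¬ conn) {J : Type} [Finite J]
    {Q : J → ∀ D : Database S V, (α → {a : V // a ∈ adom D}) → Prop}
    (hQ : ∀ j, HasNormalForm A conn plain (Q j)) :
    HasNormalForm A conn plain fun D e => ∀ j, Q j D e := by
  choose I hI κ hκ c hc hs using hQ
  refine ⟨∀ j, I j, inferInstance, fun i => Σ j, κ j (i j), fun i => inferInstance,
    fun i => Conj.glue (fun j => c j (i j)) (fun j => Sum.map id fun a => ⟨j, a⟩) ∅,
    fun i => Conj.Ok.glue (fun j => hc j (i j)) (fun h => absurd h hconn)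
      (fun h => absurd h hconn) fun _ => rfl, fun D e => ?_⟩
  simp only [hs, Conj.sat_glue, Set.mem_empty_iff_false, false_imp_iff, implies_true, and_true]
  constructor
  · intro h
    choose i z hz using h
    refine ⟨i, fun p => z p.1 p.2, fun j => ?_⟩
    convert hz j using 1
    funext a
    rcases a with a | a <;> rfl
  · rintro ⟨i, z, h⟩ j
    refine ⟨i j, fun a => z ⟨j, a⟩, ?_⟩
    convert h j using 1
    funext a
    rcases a with a | a <;> rfl

theorem reindex {Q : ∀ D : Database S V, (α → {a : V // a ∈ adom D}) → Prop}
    (hQ : HasNormalForm A conn plain Q) (r : α → β) (hr : conn → Function.Surjective r)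
    (hα : conn → Nonempty α) : HasNormalForm A conn plain fun D e => Q D (e ∘ r) := by
  obtain ⟨I, hI, κ, hκ, c, hc, hs⟩ := hQ
  refine ⟨I, hI, κ, hκ, fun i => (c i).map (Sum.map r id), fun i => Conj.Ok.glue
    (fun _ => hc i) (fun h => ?_) (fun h => ⟨_, fun _ => ⟨Sum.inl (hα h).some, rfl⟩⟩)
    fun _ => rfl, fun D e => ?_⟩
  · rintro (b | z)
    · obtain ⟨a, rfl⟩ := hr h b
      exact ⟨(), Sum.inl a, rfl⟩
    · exact ⟨(), Sum.inr z, rfl⟩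
  · simp [hs, Conj.sat_map, Sum.elim_comp_map]

end HasNormalForm

theorem atLeast_iff {D : Database S V} {k : ℕ} {P : {a : V // a ∈ adom D} → Prop} :
    AtLeast D k P ↔ ∃ y : Fin k → {a : V // a ∈ adom D}, Function.Injective y ∧ ∀ j, P (y j) := by
  classical
  have : Set.ncard {y | P y} = Fintype.card {y // P y} := by
    rw [← Nat.card_coe_set_eq, ← Nat.card_eq_fintype_card]
    rfl
  rw [AtLeast, this]
  have h := Function.Embedding.nonempty_iff_card_le (α := Fin k) (β := {y // P y})
  rw [Fintype.card_fin] at h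
  rw [← h]
  constructor
  · rintro ⟨f⟩
    exact ⟨fun j => (f j).1, Subtype.val_injective.comp f.injective, fun j => (f j).2⟩
  · rintro ⟨y, hy, hP⟩
    exact ⟨⟨fun j => ⟨y j, hP j⟩, fun i j h => hy (congrArg Subtype.val h)⟩⟩

namespace HasNormalForm

variable {A : ValueProperty S V → Prop} {α β : Type}

/-- A disjunct is chosen for each of the `k` witnesses, and the chosen conjunctions are glued along
`α` with the witnesses made pairwise distinct. Linking the copies requires a shared variable, and
covering `α` at least one copy; for `k ≤ 1` no inequality arises. -/
theorem atLeast {Q : ∀ D : Database S V, (Option α → {a : V // a ∈ adom D}) → Prop}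
    (hQ : HasNormalForm A conn plain Q) {k : ℕ} (hconn : conn → Nonempty α ∧ 1 ≤ k)
    (hplain : plain → k ≤ 1) :
    HasNormalForm A conn plain fun D e => AtLeast D k fun y => Q D fun o => o.elim y e := by
  obtain ⟨I, hI, κ, hκ, c, hc, hs⟩ := hQ
  let ρ : ∀ (i : Fin k → I) (j : Fin k), Option α ⊕ κ (i j) → α ⊕ Σ j, Option (κ (i j)) :=
    fun i j => Sum.elim (fun o => o.elim (Sum.inr ⟨j, none⟩) Sum.inl)
      fun z => Sum.inr ⟨j, some z⟩
  refine ⟨Fin k → I, inferInstance, fun i => Σ j, Option (κ (i j)), fun i => inferInstance,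
    fun i => Conj.glue (fun j => c (i j)) (ρ i)
      {p | ∃ j j', j ≠ j' ∧ p = (Sum.inr ⟨j, none⟩, Sum.inr ⟨j', none⟩)},
    fun i => Conj.Ok.glue (fun j => hc (i j)) ?_ ?_ ?_, fun D e => ?_⟩
  · rintro h (a | ⟨j, _ | z⟩)
    · exact ⟨⟨0, (hconn h).2⟩, Sum.inl (some a), rfl⟩
    · exact ⟨j, Sum.inl none, rfl⟩
    · exact ⟨j, Sum.inr z, rfl⟩
  · exact fun h => ⟨Sum.inl (hconn h).1.some, fun j => ⟨Sum.inl (some _), rfl⟩⟩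
  · intro h
    refine Set.eq_empty_of_forall_notMem ?_
    rintro _ ⟨j, j', hj, -⟩
    have := hplain h
    exact hj (Fin.ext (by lia))
  · simp only [atLeast_iff, hs, Conj.sat_glue]
    constructor
    · rintro ⟨y, hy, h⟩
      choose i z hz using h
      refine ⟨i, fun p => p.2.elim (y p.1) (z p.1), fun j => ?_, ?_⟩
      · convert hz j using 1
        funext a
        rcases a with (_ | a) | a <;> rfl
      · rintro _ ⟨j, j', hj, rfl⟩
        exact hy.ne hj
    · rintro ⟨i, z, h, hne⟩
      refine ⟨fun j => z ⟨j, none⟩, fun j j' hj => ?_, fun j =>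
        ⟨i j, fun a => z ⟨j, some a⟩, ?_⟩⟩
      · by_contra hne'
        exact hne _ ⟨j, j', hne', rfl⟩ hj
      · convert h j using 1
        funext a
        rcases a with (_ | a) | a <;> rfl

theorem countBlock {m : ℕ} : ∀ {α : Type} {k : Fin m → ℕ}
    {Q : ∀ D : Database S V, (α ⊕ Fin m → {a : V // a ∈ adom D}) → Prop},
    HasNormalForm A conn plain Q → (conn → Nonempty α ∧ ∀ j, 1 ≤ k j) →
    (plain → ∀ j, k j ≤ 1) →
    HasNormalForm A conn plain fun D e => CountBlock D m k fun ys => Q D (Sum.elim e ys) := by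
  induction m with
  | zero =>
    intro α k Q hQ hconn _
    have := hQ.reindex (Sum.elim id Fin.elim0) (fun _ a => ⟨Sum.inl a, rfl⟩)
      fun h => ⟨Sum.inl (hconn h).1.some⟩
    change HasNormalForm A conn plain fun D e => Q D (Sum.elim e Fin.elim0)
    convert this using 4 with D e
    funext a
    rcases a with a | a
    · rfl
    · exact a.elim0
  | succ m ih =>
    intro α k Q hQ hconn hplain
    -- The outermost quantified variable becomes `none`, a free variable of the remaining inner
    -- block.
    let r : α ⊕ Fin (m + 1) → Option α ⊕ Fin m :=
      Sum.elim (Sum.inl ∘ some) (Fin.cons (Sum.inl none) Sum.inr)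
    have h₁ := hQ.reindex r (by
      rintro - ((_ | a) | j)
      · exact ⟨Sum.inr 0, rfl⟩
      · exact ⟨Sum.inl a, rfl⟩
      · exact ⟨Sum.inr j.succ, rfl⟩) fun h => ⟨Sum.inl (hconn h).1.some⟩
    have h₂ := ih (k := fun j => k j.succ) h₁ (fun h => ⟨⟨none⟩, fun j => (hconn h).2 _⟩)
      fun h j => hplain h _
    have h₃ := h₂.atLeast (k := k 0) (fun h => ⟨(hconn h).1, (hconn h).2 0⟩)
      fun h => hplain h 0
    have : ∀ (D : Database S V) (e : α → {a : V // a ∈ adom D}) (y : {a : V // a ∈ adom D})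
        (ys : Fin m → {a : V // a ∈ adom D}),
        Sum.elim (fun o : Option α => o.elim y e) ys ∘ r = Sum.elim e (Fin.cons y ys) := by
      intro D e y ys
      funext a
      rcases a with a | a
      · rfl
      · induction a using Fin.cases <;> rfl
    simp only [this] at h₃
    exact h₃

theorem adjoinable [Infinite V] (hagg : AggSpec agg wt)
    (hwt : ¬ plain → wt = fun n : ℕ => (n : ℝ)) [Unique α]
    {Q : ∀ D : Database S V, (α → {a : V // a ∈ adom D}) → Prop}
    (hQ : HasNormalForm (Adjoinable agg conn) conn plain Q) :
    Adjoinable agg conn {X | Q X.db fun _ => X.pt} := by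
  obtain ⟨I, hI, κ, hκ, c, hc, hs⟩ := hQ
  have := Adjoinable.iUnion hagg fun i => adjoinable_of_conj hagg hwt (Sum.inl default) (hc i)
  convert this using 1
  ext X
  simp only [Set.mem_ofPred_eq, hs, Set.mem_iUnion]
  refine exists_congr fun i => ⟨fun ⟨z, hz⟩ => ⟨_, rfl, hz⟩, fun ⟨g, hg, hz⟩ =>
    ⟨fun z => g (Sum.inr z), ?_⟩⟩
  convert hz using 1
  funext a
  rcases a with a | a
  · rw [Unique.eq_default a]
    exact hg.symm
  · rfl

end HasNormalForm

/-- Unary negation is what makes the induction work: the negated formula defines a value property,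
which is adjoinable by its own normal form, so its complement can serve as a unary condition in a
conjunction. -/
theorem UNFOC.hasNormalForm [Infinite V] (hagg : AggSpec agg wt)
    (hwt : ¬ plain → wt = fun n : ℕ => (n : ℝ)) {n : ℕ} (φ : UNFOC S n)
    (hφ : plain → φ.IsUNFO) :
    HasNormalForm (V := V) (Adjoinable agg False) False plain fun D e => φ.Sat D e := by
  induction φ with
  | rel R x =>
    have := HasNormalForm.of_conj (A := Adjoinable (S := S) (V := V) agg False) (conn := False)
      (plain := plain) False.elim (c := ⟨{⟨R, x⟩}, ∅, ∅⟩)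
      ⟨Set.finite_empty, by simp, False.elim, False.elim, fun _ => rfl⟩
    simp only [Conj.Sat, Set.mem_singleton_iff, forall_eq, Set.mem_empty_iff_false, false_imp_iff,
      implies_true, and_true] at this
    exact this
  | and φ ψ ihφ ihψ =>
    have := HasNormalForm.forall_of_forall (J := Bool) not_false (Q := fun b D e =>
      cond b (φ.Sat D e) (ψ.Sat D e)) fun b => by
        cases b
        · exact ihψ fun h => (hφ h).2
        · exact ihφ fun h => (hφ h).1
    convert this using 3 with D e
    simp [UNFOC.Sat, and_comm]
  | or φ ψ ihφ ihψ =>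
    have := HasNormalForm.exists_of_forall (J := Bool) (Q := fun b D e =>
      cond b (φ.Sat D e) (ψ.Sat D e)) fun b => by
        cases b
        · exact ihψ fun h => (hφ h).2
        · exact ihφ fun h => (hφ h).1
    convert this using 3 with D e
    simp [UNFOC.Sat, or_comm]
  | @ex n k φ ih =>
    have h := (ih fun h => (hφ h).2).reindex (Fin.snoc (α := fun _ => Option (Fin n)) some none)
      False.elim False.elim
    have := h.atLeast (k := k) False.elim fun h => (hφ h).1.le
    change HasNormalForm _ _ _ fun D e => AtLeast D k fun y => φ.Sat D (Fin.snoc e y)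
    convert this using 5 with D e y
    refine iff_of_eq (congrArg _ (funext fun i => ?_))
    induction i using Fin.lastCases <;> simp
  | neg i φ ih =>
    have h := ((ih hφ).adjoinable hagg hwt).compl hagg
    have := HasNormalForm.of_conj (plain := plain) False.elim
      (c := ⟨∅, {(i, {X | φ.Sat X.db fun _ => X.pt}ᶜ)}, ∅⟩)
      ⟨Set.finite_singleton _, by simpa using h, False.elim, False.elim, fun _ => rfl⟩
    simp only [Conj.Sat, Set.mem_singleton_iff, forall_eq, Set.mem_empty_iff_false, false_imp_iff,
      implies_true, and_true, true_and] at this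
    exact this

/-- A presentation by the database itself, if all values are active. -/
def presentationOfAdomEqUniv [Fintype ι] (D : Database S ι) (h : adom D = Finset.univ) :
    Presentation D (D : Set (Fact S ι)) where
  e := (Equiv.subtypeUnivEquiv fun a => h ▸ Finset.mem_univ a).symm
  mem_iff _ := Iff.rfl

/-- The conditions on connected formulas are those that gluing needs: positive bounds, and atoms of
each disjunct that cover and link all variables. -/
theorem GHML.adjoinable [Infinite V] (hagg : AggSpec agg fun n : ℕ => (n : ℝ)) (φ : GHML S)
    (hφ : conn → φ.IsConnected) :
    Adjoinable (V := V) agg conn {X | φ.Sat X.db X.pt} := by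
  induction φ with
  | neg φ ih => exact (ih hφ).compl hagg
  | or φ ψ ihφ ihψ => exact (ihφ fun h => (hφ h).1).union hagg (ihψ fun h => (hφ h).2)
  | ex m k l atoms p var sub ih =>
    let c : Fin l → Conj S V (Fin (m + 1)) := fun i =>
      ⟨atoms i, Set.range fun j => (var i j, {X | (sub i j).Sat X.db X.pt}), ∅⟩
    have hc : ∀ i, (c i).Ok (Adjoinable agg conn) conn False := by
      intro i
      refine ⟨Set.finite_range _, ?_, fun h => ?_, fun h => ?_, False.elim⟩
      · rintro _ ⟨j, rfl⟩
        exact ih i j fun h => ((hφ h).2 i).2 j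
      · exact (presentationOfAdomEqUniv _ ((hφ h).2 i).1.1).covered
      · exact ((presentationOfAdomEqUniv _ ((hφ h).2 i).1.1).gaifman_connected_iff.1
          ((hφ h).2 i).1.2).2
    have h₁ := (HasNormalForm.exists_of_forall fun i =>
      HasNormalForm.of_conj (fun _ => ⟨0⟩) (hc i)).reindex
        (Fin.cons (Sum.inl ()) Sum.inr : Fin (m + 1) → Unit ⊕ Fin m) (by
          rintro - (_ | j)
          · exact ⟨0, rfl⟩
          · exact ⟨j.succ, rfl⟩) fun _ => ⟨0⟩
    have h₂ := (h₁.countBlock (k := k) (fun h => ⟨⟨()⟩, (hφ h).1⟩) False.elim).adjoinable hagg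
      fun _ => rfl
    have : ∀ (D : Database S V) (w : {a : V // a ∈ adom D}) (ys : Fin m → {a : V // a ∈ adom D}),
        Sum.elim (fun _ : Unit => w) ys ∘
          (Fin.cons (Sum.inl ()) Sum.inr : Fin (m + 1) → Unit ⊕ Fin m) = Fin.cons w ys := by
      intro D w ys
      funext a
      induction a using Fin.cases <;> rfl
    simp only [this] at h₂
    simp only [Conj.Sat, c, Set.forall_mem_range, Set.mem_empty_iff_false, false_imp_iff,
      implies_true, and_true] at h₂
    exact h₂

theorem exists_network_of_adjoinable {Q : ValueProperty S V} (hQ : Adjoinable agg conn Q) :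
    ∃ N : DHN S V, N.UsesOnly agg ∧ (conn → N.IsConnected) ∧ N.IsSimple ∧
      Q = {X | N.Accepts X} := by
  classical
  -- The empty network computes the empty family of properties.
  obtain ⟨d, N, P, hN, -, k, rfl⟩ := hQ 0 .nil Fin.elim0 ⟨trivial, fun _ _ k => k.elim0⟩
  refine ⟨⟨d, N, fun x => decide (x k ≥ ((1 : ℚ) : ℝ))⟩, hN.1.mono fun L h => h.1,
    fun hc => hN.1.mono fun L h => h.2.1 hc,
    ⟨hN.1.mono fun L h => h.2.2, 1, k, .inr fun x => by simp⟩, ?_⟩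
  ext X
  simp only [DHN.Accepts, Set.mem_ofPred_eq, decide_eq_true_eq, hN.2]
  split_ifs with h <;> simp [h]

end NormalForms

/-! ### From HML to UNFO -/

section UnaryNegation

variable {S : Schema.{u}} {V : Type v}

/-- The relation `Q` is defined by a formula of the unary negation fragment. -/
def UNFODefinable (n : ℕ) (Q : ∀ D : Database S V, (Fin n → {a : V // a ∈ adom D}) → Prop) :
    Prop :=
  ∃ φ : UNFOC S n, φ.IsUNFO ∧ ∀ D e, φ.Sat D e ↔ Q D e

namespace UNFODefinable

/-- A double unary negation moves a one-variable formula into a larger context. -/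
theorem unary {n : ℕ} {Q : ∀ D : Database S V, (Fin 1 → {a : V // a ∈ adom D}) → Prop}
    (hQ : UNFODefinable 1 Q) (i : Fin n) : UNFODefinable n fun D e => Q D fun _ => e i := by
  obtain ⟨φ, hφ, hs⟩ := hQ
  exact ⟨.neg i (.neg 0 φ), hφ, fun D e => by simp [UNFOC.Sat, hs]⟩

theorem and {n : ℕ} {P Q : ∀ D : Database S V, (Fin n → {a : V // a ∈ adom D}) → Prop}
    (hP : UNFODefinable n P) (hQ : UNFODefinable n Q) :
    UNFODefinable n fun D e => P D e ∧ Q D e := by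
  obtain ⟨φ, hφ, hs⟩ := hP
  obtain ⟨ψ, hψ, ht⟩ := hQ
  exact ⟨.and φ ψ, ⟨hφ, hψ⟩, fun D e => by simp [UNFOC.Sat, hs, ht]⟩

/-- The empty conjunction has to be written with some atom; this is where a relation symbol is
needed. -/
theorem tautology (R : S.Rel) {n : ℕ} (i : Fin n) :
    UNFODefinable (S := S) (V := V) n fun _ _ => True :=
  unary (S := S) (Q := fun _ _ => True) ⟨.or (.rel R fun _ => 0) (.neg 0 (.rel R fun _ => 0)),
    ⟨trivial, trivial⟩, fun D e => by
      simp only [UNFOC.Sat, iff_true]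
      exact em _⟩ i

theorem forall_mem (R : S.Rel) {n : ℕ} (i : Fin n) {J : Type*} {T : Set J} (hT : T.Finite)
    {Q : J → ∀ D : Database S V, (Fin n → {a : V // a ∈ adom D}) → Prop}
    (hQ : ∀ j, UNFODefinable n (Q j)) : UNFODefinable n fun D e => ∀ j ∈ T, Q j D e := by
  induction T, hT using Set.Finite.induction_on with
  | empty => simpa using tautology (V := V) R i
  | insert _ _ ih => simpa using (hQ _).and ih

theorem exists_append {n : ℕ} : ∀ {m : ℕ}
    {Q : ∀ D : Database S V, (Fin (n + m) → {a : V // a ∈ adom D}) → Prop},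
    UNFODefinable (n + m) Q →
      UNFODefinable n fun D e => ∃ ys : Fin m → {a : V // a ∈ adom D}, Q D (Fin.append e ys)
  | 0, Q, hQ => by
    obtain ⟨φ, hφ, hs⟩ := hQ
    refine ⟨φ, hφ, fun D e => (hs D e).trans ?_⟩
    have : ∀ ys : Fin 0 → {a : V // a ∈ adom D}, Fin.append e ys = e := fun ys => by
      rw [Subsingleton.elim ys Fin.elim0, Fin.append_elim0]
      rfl
    simp [this]
  | m + 1, Q, hQ => by
    obtain ⟨φ, hφ, hs⟩ := hQ
    have h : UNFODefinable (n + m) fun D e => ∃ y, Q D (Fin.snoc e y) :=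
      ⟨.ex 1 φ, ⟨rfl, hφ⟩, fun D e => by
        simp only [UNFOC.Sat, atLeast_iff, hs]
        exact ⟨fun ⟨y, _, h⟩ => ⟨_, h 0⟩, fun ⟨y, h⟩ =>
          ⟨fun _ => y, Function.injective_of_subsingleton _, fun _ => h⟩⟩⟩
    obtain ⟨ψ, hψ, ht⟩ := exists_append h
    refine ⟨ψ, hψ, fun D e => (ht D e).trans ?_⟩
    constructor
    · rintro ⟨ys, y, h⟩
      exact ⟨Fin.snoc ys y, by rwa [Fin.append_snoc]⟩
    · rintro ⟨ys, h⟩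
      refine ⟨Fin.init ys, ys (Fin.last m), ?_⟩
      rwa [← Fin.append_snoc, Fin.snoc_init_self]

end UNFODefinable

theorem HML.unfoDefinable (R : S.Rel) (φ : HML S) :
    UNFODefinable (V := V) 1 fun D e => φ.Sat D (e 0) := by
  induction φ with
  | neg φ ih =>
    obtain ⟨ψ, hψ, hs⟩ := ih
    exact ⟨.neg 0 ψ, hψ, fun D e => not_congr (hs D _)⟩
  | or φ₁ φ₂ ih₁ ih₂ =>
    obtain ⟨ψ₁, h₁, hs₁⟩ := ih₁
    obtain ⟨ψ₂, h₂, hs₂⟩ := ih₂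
    exact ⟨.or ψ₁ ψ₂, ⟨h₁, h₂⟩, fun D e => or_congr (hs₁ D e) (hs₂ D e)⟩
  | ex m atoms p var sub ih =>
    have hm : m + 1 = 1 + m := add_comm _ _
    have ha := UNFODefinable.forall_mem (V := V) R (0 : Fin (1 + m)) (Finset.finite_toSet atoms)
      (Q := fun f D e => (⟨f.1, fun i => (e (Fin.cast hm (f.2 i))).1⟩ : Fact S V) ∈ D)
      fun f => ⟨.rel f.1 fun i => Fin.cast hm (f.2 i), trivial, fun D e => Iff.rfl⟩
    have hs := UNFODefinable.forall_mem (V := V) R (0 : Fin (1 + m))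
      (Set.finite_univ (α := Fin p)) fun j => (ih j).unary (Fin.cast hm (var j))
    obtain ⟨ψ, hψ, h⟩ := (ha.and hs).exists_append
    refine ⟨ψ, hψ, fun D e => (h D e).trans (exists_congr fun ys => ?_)⟩
    have : ∀ i, Fin.append e ys (Fin.cast hm i) =
        (Fin.cons (e 0) ys : Fin (m + 1) → {a : V // a ∈ adom D}) i := by
      intro i
      rw [Fin.append_left_eq_cons]
      rfl
    simp only [this, Set.mem_univ, true_imp_iff]
    rfl

end UnaryNegation

/-! ### From networks to logic: functions determined by finitely many properties -/

section Definability

variable {S : Schema.{u}} {V : Type v}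

/-- On `K`, the function `f` depends only on finitely many of the value properties in `𝓕`. -/
def FinDetermined (K : Set (PointedDatabase S V)) (𝓕 : Set (ValueProperty S V)) {Z : Type*}
    (f : PointedDatabase S V → Z) : Prop :=
  ∃ 𝒜 : Set (ValueProperty S V), 𝒜.Finite ∧ 𝒜 ⊆ 𝓕 ∧
    ∀ X ∈ K, ∀ Y ∈ K, (∀ P ∈ 𝒜, X ∈ P ↔ Y ∈ P) → f X = f Y

/-- Closure under Boolean operations. -/
structure BoolClosed (𝓕 : Set (ValueProperty S V)) : Prop where
  univ : Set.univ ∈ 𝓕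
  compl : ∀ P ∈ 𝓕, Pᶜ ∈ 𝓕
  union : ∀ P ∈ 𝓕, ∀ Q ∈ 𝓕, P ∪ Q ∈ 𝓕

namespace BoolClosed

variable {𝓕 : Set (ValueProperty S V)}

theorem sUnion (h : BoolClosed 𝓕) {𝒜 : Set (ValueProperty S V)} (hfin : 𝒜.Finite)
    (h𝒜 : 𝒜 ⊆ 𝓕) : ⋃₀ 𝒜 ∈ 𝓕 := by
  induction 𝒜, hfin using Set.Finite.induction_on with
  | empty => simpa using h.compl _ h.univ
  | @insert P 𝒜 _ _ ih =>
    rw [Set.sUnion_insert]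
    exact h.union _ (h𝒜 (Set.mem_insert _ _)) _ (ih ((Set.subset_insert _ _).trans h𝒜))

theorem iUnion (h : BoolClosed 𝓕) {J : Type*} [Finite J] {P : J → ValueProperty S V}
    (hP : ∀ j, P j ∈ 𝓕) : ⋃ j, P j ∈ 𝓕 := by
  rw [← Set.sUnion_range]
  exact h.sUnion (Set.finite_range P) (by rintro _ ⟨j, rfl⟩; exact hP j)

theorem iInter (h : BoolClosed 𝓕) {J : Type*} [Finite J] {P : J → ValueProperty S V}
    (hP : ∀ j, P j ∈ 𝓕) : ⋂ j, P j ∈ 𝓕 := by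
  rw [← compl_compl (⋂ j, P j), Set.compl_iInter]
  exact h.compl _ (h.iUnion fun j => h.compl _ (hP j))

theorem type_mem (h : BoolClosed 𝓕) {J : Type*} [Finite J] {P : J → ValueProperty S V}
    (hP : ∀ j, P j ∈ 𝓕) (s : J → Prop) : {X | (fun j => X ∈ P j) = s} ∈ 𝓕 := by
  classical
  have : {X | (fun j => X ∈ P j) = s} = ⋂ j, if s j then P j else (P j)ᶜ := by
    ext X
    simp only [Set.mem_ofPred_eq, funext_iff, Set.mem_iInter, eq_iff_iff]
    refine forall_congr' fun j => ?_
    split_ifs with hs <;> simp [hs]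
  rw [this]
  refine h.iInter fun j => ?_
  split_ifs
  · exact hP j
  · exact h.compl _ (hP j)

end BoolClosed

namespace FinDetermined

variable {K : Set (PointedDatabase S V)} {𝓕 : Set (ValueProperty S V)} {Z Z' : Type*}

theorem of_determined {f : PointedDatabase S V → Z} {g : PointedDatabase S V → Z'}
    (hf : FinDetermined K 𝓕 f) (h : ∀ X ∈ K, ∀ Y ∈ K, f X = f Y → g X = g Y) :
    FinDetermined K 𝓕 g := by
  obtain ⟨𝒜, h₁, h₂, h₃⟩ := hf
  exact ⟨𝒜, h₁, h₂, fun X hX Y hY hXY => h X hX Y hY (h₃ X hX Y hY hXY)⟩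

theorem pi {J : Type*} [Finite J] {Z : J → Type*} {f : ∀ j, PointedDatabase S V → Z j}
    (hf : ∀ j, FinDetermined K 𝓕 (f j)) : FinDetermined K 𝓕 fun X j => f j X := by
  choose 𝒜 h₁ h₂ h₃ using hf
  exact ⟨⋃ j, 𝒜 j, Set.finite_iUnion h₁, Set.iUnion_subset h₂, fun X hX Y hY h => funext fun j =>
    h₃ j X hX Y hY fun P hP => h P (Set.mem_iUnion.2 ⟨j, hP⟩)⟩

theorem of_mem {P : ValueProperty S V} (hP : P ∈ 𝓕) {f : PointedDatabase S V → Prop}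
    (h : ∀ X ∈ K, X ∈ P ↔ f X) : FinDetermined K 𝓕 f :=
  ⟨{P}, Set.finite_singleton _, by simpa using hP, fun X hX Y hY hXY => propext <| by
    rw [← h X hX, ← h Y hY, hXY P rfl]⟩

/-- Finitely many properties have finitely many types; the union of the types realised in `K` by
points satisfying `f` works. -/
theorem exists_mem (h𝓕 : BoolClosed 𝓕) {f : PointedDatabase S V → Prop}
    (hf : FinDetermined K 𝓕 f) : ∃ P ∈ 𝓕, ∀ X ∈ K, X ∈ P ↔ f X := by
  obtain ⟨𝒜, h₁, h₂, h₃⟩ := hf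
  have := h₁.to_subtype
  refine ⟨⋃ s : {s : 𝒜 → Prop // ∃ Y ∈ K, f Y ∧ (fun P : 𝒜 => Y ∈ P.1) = s},
    {X | (fun P : 𝒜 => X ∈ P.1) = s}, h𝓕.iUnion fun s => h𝓕.type_mem (fun P => h₂ P.2) _,
    fun X hX => ?_⟩
  simp only [Set.mem_iUnion, Set.mem_ofPred_eq]
  constructor
  · rintro ⟨⟨_, Y, hY, hfY, rfl⟩, h⟩
    rwa [h₃ X hX Y hY fun P hP => iff_of_eq (congrFun h ⟨P, hP⟩)]
  · exact fun h => ⟨⟨_, X, hX, h, rfl⟩, rfl⟩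

/-- The numbers of homomorphisms from `F` that send the values of `F` to prescribed value
properties are determined, as far as `v` sees them, by finitely many value properties. -/
def _root_.HomNet.HomCountsDetermined (K : Set (PointedDatabase S V))
    (𝓕 : Set (ValueProperty S V)) (v : ℕ → Z) (F : PointedDatabase S V) : Prop :=
  ∀ Q : {a : V // a ∈ adom F.db} → ValueProperty S V, (∀ a, Q a ∈ 𝓕) →
    FinDetermined K 𝓕 fun X => v (Nat.card {h : Hom F X //
      ∀ a, (⟨X.db, h.1 a⟩ : PointedDatabase S V) ∈ Q a})

/-- By `hv`, the aggregation sees a multiset only through `v` of its multiplicities. For the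
multiset of type assignments induced by the homomorphisms these multiplicities are the counts in
`hF`, one for each of finitely many assignments `τ`. -/
theorem eval (hK : ∀ X ∈ K, ∀ w, (⟨X.db, w⟩ : PointedDatabase S V) ∈ K) (h𝓕 : BoolClosed 𝓕)
    {v : ℕ → Z} {d d' : ℕ} (q : HomQuery S V d d')
    (hv : ∀ {T : Type (max u v)} [DecidableEq T] (M M' : Multiset T),
      (∀ t, v (M.count t) = v (M'.count t)) → ∀ G : T → ℝ, q.agg (M.map G) = q.agg (M'.map G))
    (hF : HomCountsDetermined K 𝓕 v q.F) {f : PointedDatabase S V → Fin d → ℝ}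
    (hf : FinDetermined K 𝓕 f) :
    FinDetermined K 𝓕 fun X => q.eval X.db (fun y => f ⟨X.db, y⟩) X.pt := by
  classical
  obtain ⟨𝒜, h₁, h₂, h₃⟩ := hf
  have := h₁.to_subtype
  let type : PointedDatabase S V → 𝒜 → Prop := fun X P => X ∈ P.1
  -- On `K` the embedding factors through the type; types not realised in `K` get the value 0.
  obtain ⟨G, hG⟩ : ∃ G : (𝒜 → Prop) → Fin d → ℝ, ∀ X ∈ K, f X = G (type X) := by
    refine ⟨fun s => if h : ∃ X ∈ K, type X = s then f h.choose else 0, fun X hX => ?_⟩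
    beta_reduce
    split_ifs with h
    · exact h₃ X hX _ h.choose_spec.1 fun P hP =>
        iff_of_eq (congrFun h.choose_spec.2 ⟨P, hP⟩).symm
    · exact absurd ⟨X, hX, rfl⟩ h
  have hk := FinDetermined.pi fun τ : {a : V // a ∈ adom q.F.db} → 𝒜 → Prop =>
    hF (fun a => {X | type X = τ a}) fun a => h𝓕.type_mem (fun P => h₂ P.2) _
  refine hk.of_determined fun X hX Y hY hXY => ?_
  let M : PointedDatabase S V → Multiset ({a : V // a ∈ adom q.F.db} → 𝒜 → Prop) := fun X =>
    (Finset.univ : Finset (Hom q.F X)).val.map fun h a => type ⟨X.db, h.1 a⟩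
  have hM : ∀ X τ, (M X).count τ = Nat.card {h : Hom q.F X //
      ∀ a, (⟨X.db, h.1 a⟩ : PointedDatabase S V) ∈ {X | type X = τ a}} := by
    intro X τ
    rw [Multiset.count_map, Nat.card_eq_fintype_card, Fintype.card_subtype, Finset.card_def,
      Finset.filter_val]
    congr 1
    refine Multiset.filter_congr fun h _ => ?_
    rw [eq_comm, funext_iff]
    rfl
  have heval : ∀ X ∈ K, q.eval X.db (fun y => f ⟨X.db, y⟩) X.pt =
      fun j => q.agg ((M X).map fun τ => ∏ a, q.trans a (G (τ a)) j) := by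
    intro X hX
    funext j
    simp only [HomQuery.eval, M, Multiset.map_map, Function.comp_def, hG _ (hK X hX _)]
  rw [heval X hX, heval Y hY]
  funext j
  refine hv _ _ (fun τ => ?_) _
  rw [hM, hM]
  exact congrFun hXY τ

theorem embed (hK : ∀ X ∈ K, ∀ w, (⟨X.db, w⟩ : PointedDatabase S V) ∈ K) (h𝓕 : BoolClosed 𝓕)
    {agg : Aggregation} {v : ℕ → Z} {good : PointedDatabase S V → Prop}
    (hv : ∀ {T : Type (max u v)} [DecidableEq T] (M M' : Multiset T),
      (∀ t, v (M.count t) = v (M'.count t)) →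
      ∀ G : T → ℝ, agg (M.map G) = agg (M'.map G))
    (hF : ∀ F, good F → HomCountsDetermined K 𝓕 v F) {d : ℕ} (N : Layers S V d)
    (hN : N.All fun L => ∀ i, (L.query i).agg = agg ∧ good (L.query i).F) :
    FinDetermined K 𝓕 fun X => N.embed X.db X.pt := by
  classical
  induction N with
  | nil => exact ⟨∅, Set.finite_empty, Set.empty_subset _, fun X _ Y _ _ => rfl⟩
  | snoc N L ih =>
    refine (FinDetermined.pi fun i => (ih hN.1).eval hK h𝓕 (L.query i) ?_
      (hF _ (hN.2 i).2)).of_determined fun X _ Y _ h => congrArg L.com h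
    rw [(hN.2 i).1]
    exact hv

end FinDetermined

theorem exists_mem_of_network {K : Set (PointedDatabase S V)} {𝓕 : Set (ValueProperty S V)}
    {Z : Type*} (hK : ∀ X ∈ K, ∀ w, (⟨X.db, w⟩ : PointedDatabase S V) ∈ K)
    (h𝓕 : BoolClosed 𝓕) {agg : Aggregation} {v : ℕ → Z} {good : PointedDatabase S V → Prop}
    (hv : ∀ {T : Type (max u v)} [DecidableEq T] (M M' : Multiset T),
      (∀ t, v (M.count t) = v (M'.count t)) →
      ∀ G : T → ℝ, agg (M.map G) = agg (M'.map G))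
    (hF : ∀ F, good F → HomCountsDetermined K 𝓕 v F) (N : DHN S V)
    (hN : N.layers.All fun L => ∀ i, (L.query i).agg = agg ∧ good (L.query i).F) :
    ∃ P ∈ 𝓕, ∀ X ∈ K, X ∈ P ↔ N.Accepts X :=
  ((FinDetermined.embed hK h𝓕 hv hF N.layers hN).of_determined
    (g := fun X => N.Accepts X) fun X _ Y _ h => by
      simp only [DHN.Accepts]
      rw [h]).exists_mem h𝓕

/-- The conjunction that describes the homomorphisms from `F` that send the values of `F` to
prescribed value properties. -/
theorem exists_conj (F : PointedDatabase S V)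
    (Q : {a : V // a ∈ adom F.db} → ValueProperty S V) :
    ∃ (m : ℕ) (A : Set (Fact S (Fin (m + 1)))) (p : Presentation F.db A),
      ∀ X : PointedDatabase S V,
        Nat.card {h : Hom F X // ∀ a, (⟨X.db, h.1 a⟩ : PointedDatabase S V) ∈ Q a} =
        Nat.card {ys : Fin m → {a : V // a ∈ adom X.db} //
          (∀ f ∈ A, Fact.map (fun a =>
            ((Fin.cons X.pt ys : Fin (m + 1) → {a : V // a ∈ adom X.db}) a).1) f ∈ X.db) ∧
          ∀ j, (⟨X.db, (Fin.cons X.pt ys : Fin (m + 1) → {a : V // a ∈ adom X.db}) j⟩ :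
            PointedDatabase S V) ∈ Q (p.e j)} := by
  obtain ⟨m, A, p, hp⟩ := exists_presentation F
  refine ⟨m, A, p, fun X => ?_⟩
  have h := Conj.count_eq_card_hom (c := ⟨A, Set.range fun j => (j, Q (p.e j)), ∅⟩) p hp rfl X
  have hall : ∀ h : Hom F X, (∀ a, (⟨X.db, h.1 a⟩ : PointedDatabase S V) ∈ Q a) ↔
      ∀ u ∈ Set.range fun j => (j, Q (p.e j)),
        (⟨X.db, h.1 (p.e u.1)⟩ : PointedDatabase S V) ∈ u.2 := fun h => by
    rw [Set.forall_mem_range, p.e.forall_congr_left]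
    simp
  simp only [hall]
  rw [← h, Conj.count]
  simp only [Conj.Sat, Set.forall_mem_range, Set.mem_empty_iff_false, false_imp_iff,
    implies_true, and_true]
  have hcons : ∀ g : Fin (m + 1) → {a : V // a ∈ adom X.db}, g 0 = X.pt →
      (Fin.cons X.pt fun j : Fin m => g j.succ : Fin (m + 1) → {a : V // a ∈ adom X.db}) = g := by
    intro g hg
    rw [← hg]
    exact Fin.cons_self_tail g
  refine Nat.card_congr ⟨fun g => ⟨fun j => g.1 j.succ, ?_⟩, fun ys => ⟨Fin.cons X.pt ys.1,
    rfl, ys.2⟩, ?_, ?_⟩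
  · rw [hcons g.1 g.2.1]
    exact g.2.2
  · intro g
    exact Subtype.ext (hcons g.1 g.2.1)
  · intro ys
    rfl

/-! ### Homomorphism counts in HML and in connected GHML -/

theorem boolClosed_hmlClass : BoolClosed (hmlClass S V) where
  univ := ⟨.ex 0 ∅ 0 Fin.elim0 Fin.elim0, by
    ext X
    simp only [Set.mem_univ, Set.mem_ofPred_eq, true_iff]
    exact ⟨Fin.elim0, by simp, fun j => j.elim0⟩⟩
  compl := by
    rintro _ ⟨φ, rfl⟩
    exact ⟨.neg φ, rfl⟩
  union := by
    rintro _ ⟨φ, rfl⟩ _ ⟨ψ, rfl⟩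
    exact ⟨.or φ ψ, rfl⟩

theorem homCountsDetermined_hmlClass (F : PointedDatabase S V) :
    HomCountsDetermined Set.univ (hmlClass S V) (fun n => 0 < n) F := by
  intro Q hQ
  obtain ⟨m, A, p, h⟩ := exists_conj F Q
  choose φ hφ using hQ
  let ψ : HML S := .ex m (Set.toFinite A).toFinset (m + 1) id fun j => φ (p.e j)
  have hψ : {X : PointedDatabase S V | ψ.Sat X.db X.pt} ∈ hmlClass S V := ⟨ψ, rfl⟩
  refine FinDetermined.of_mem hψ fun X _ => ?_
  change _ ↔ 0 < Nat.card _
  rw [h, Nat.card_pos_iff, nonempty_subtype, and_iff_left Subtype.finite]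
  refine exists_congr fun ys => and_congr (by simp [Fact.map, Function.comp_def])
    (forall_congr' fun j => ?_)
  rw [hφ]
  rfl

theorem boolClosed_connectedGhmlClass : BoolClosed (connectedGhmlClass S V) where
  -- Truth is the negated empty disjunction: a disjunct would have to contain an atom with `x`, but
  -- with no disjuncts connectedness is vacuous.
  univ := ⟨.neg (.ex 0 Fin.elim0 0 Fin.elim0 Fin.elim0 (fun i => i.elim0) fun i => i.elim0),
    ⟨fun i => i.elim0, fun i => i.elim0⟩, by
      ext X
      simp only [Set.mem_univ, Set.mem_ofPred_eq, true_iff]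
      rintro ⟨i, -⟩
      exact i.elim0⟩
  compl := by
    rintro _ ⟨φ, hφ, rfl⟩
    exact ⟨.neg φ, hφ, rfl⟩
  union := by
    rintro _ ⟨φ, hφ, rfl⟩ _ ⟨ψ, hψ, rfl⟩
    exact ⟨.or φ ψ, ⟨hφ, hψ⟩, rfl⟩

theorem CountBlock.exists {D : Database S V} : ∀ {m : ℕ} {k : Fin m → ℕ}
    {P : (Fin m → {a : V // a ∈ adom D}) → Prop}, CountBlock D m k P → (∀ j, 1 ≤ k j) →
    ∃ ys, P ys
  | 0, _, _, h, _ => ⟨_, h⟩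
  | m + 1, k, P, h, hk => by
    obtain ⟨y, -, hy⟩ := atLeast_iff.1 h
    obtain ⟨ys, hys⟩ := (hy ⟨0, hk 0⟩).exists fun j => hk j.succ
    exact ⟨_, hys⟩

theorem card_subtype_prod {α β : Type*} [Fintype α] [Finite β] (R : α → β → Prop) :
    Nat.card {p : α × β // R p.1 p.2} = ∑ a, Nat.card {b // R a b} := by
  rw [← Nat.card_sigma]
  exact Nat.card_congr ⟨fun p => ⟨p.1.1, p.1.2, p.2⟩, fun p => ⟨(p.1, p.2.1), p.2.2⟩,
    fun _ => rfl, fun _ => rfl⟩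

theorem card_subtype_prod_right {α β : Type*} [Finite α] [Fintype β] (R : α → β → Prop) :
    Nat.card {p : α × β // R p.1 p.2} = ∑ b, Nat.card {a // R a b} := by
  rw [← card_subtype_prod fun b a => R a b]
  exact Nat.card_congr ((Equiv.prodComm _ _).subtypeEquiv fun _ => Iff.rfl)

theorem card_subtype_fin_cons {α : Type*} {m : ℕ} (R : (Fin (m + 1) → α) → Prop) :
    Nat.card {x // R x} = Nat.card {p : α × (Fin m → α) // R (Fin.cons p.1 p.2)} :=
  Nat.card_congr ⟨fun x => ⟨(x.1 0, Fin.tail x.1), by rw [Fin.cons_self_tail]; exact x.2⟩,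
    fun p => ⟨Fin.cons p.1.1 p.1.2, p.2⟩, fun x => Subtype.ext (Fin.cons_self_tail x.1),
    fun p => rfl⟩

theorem card_fin_succ_le {C n : ℕ} (h : n ≤ C) : Nat.card {k : Fin C // (k : ℕ) + 1 ≤ n} = n := by
  rw [Nat.card_congr (β := Fin n) ⟨fun k => ⟨k.1, k.2⟩, fun k =>
    ⟨⟨k, k.2.trans_le h⟩, k.2⟩, fun _ => rfl, fun _ => rfl⟩, Nat.card_fin]

/-- The number of tuples with a property is the number of tuples of thresholds for which the
quantifier block holds. -/
theorem card_eq_card_countBlock {D : Database S V} {C : ℕ} (B : Set {a : V // a ∈ adom D})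
    (hB : B.ncard ≤ C) : ∀ {m : ℕ} (P : (Fin m → {a : V // a ∈ adom D}) → Prop),
    (∀ ys, P ys → ∀ j, ys j ∈ B) →
    Nat.card {ys // P ys} = Nat.card {k : Fin m → Fin C // CountBlock D m (fun j => k j + 1) P}
  | 0, P, _ => Nat.card_congr ⟨fun y => ⟨Fin.elim0, by
      change P Fin.elim0
      rw [Subsingleton.elim Fin.elim0 y.1]
      exact y.2⟩, fun k => ⟨Fin.elim0, k.2⟩, fun _ => Subsingleton.elim _ _,
      fun _ => Subsingleton.elim _ _⟩
  | m + 1, P, hP => by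
    classical
    have ih := fun y => card_eq_card_countBlock B hB (fun ys => P (Fin.cons y ys))
      fun ys h j => hP _ h j.succ
    -- Positive thresholds guarantee a witness tuple, so every such `y` lies in `B`.
    have hle : ∀ k' : Fin m → Fin C, Set.ncard {y | CountBlock D m (fun j => k' j + 1)
        fun ys => P (Fin.cons y ys)} ≤ C := by
      refine fun k' => (Set.ncard_le_ncard (fun y hy => ?_) (Set.toFinite _)).trans hB
      obtain ⟨ys, hys⟩ := CountBlock.exists hy fun j => Nat.le_add_left 1 _
      exact hP _ hys 0
    -- Double counting: tuples are summed over the first value `y`, the tails are replaced by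
    -- thresholds `k'`, and the order of summation is exchanged. For fixed `k'`, a set of `n ≤ C`
    -- values `y` passes exactly the thresholds `1, …, n`.
    rw [card_subtype_fin_cons, card_subtype_fin_cons fun k : Fin (m + 1) → Fin C =>
        CountBlock D (m + 1) (fun j => k j + 1) P,
      card_subtype_prod fun y ys => P (Fin.cons y ys), Finset.sum_congr rfl fun y _ => ih y,
      ← card_subtype_prod fun y (k' : Fin m → Fin C) =>
        CountBlock D m (fun j => k' j + 1) fun ys => P (Fin.cons y ys),
      card_subtype_prod_right fun y (k' : Fin m → Fin C) =>
        CountBlock D m (fun j => k' j + 1) fun ys => P (Fin.cons y ys),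
      card_subtype_prod_right fun (k : Fin C) (k' : Fin m → Fin C) => CountBlock D (m + 1)
        (fun j => (Fin.cons k k' : Fin (m + 1) → Fin C) j + 1) P]
    refine Finset.sum_congr rfl fun k' _ => ?_
    exact (Nat.card_coe_set_eq _).trans (card_fin_succ_le (hle k')).symm

open scoped Classical in
/-- The values at distance at most `n` in the Gaifman graph. -/
noncomputable def ball (D : Database S V) (w : {a : V // a ∈ adom D}) :
    ℕ → Finset {a : V // a ∈ adom D}
  | 0 => {w}
  | n + 1 => ball D w n ∪ (ball D w n).biUnion fun a =>
      Finset.univ.filter fun b => Cooc (D : Set (Fact S V)) a.1 b.1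

theorem ball_mono (D : Database S V) (w : {a : V // a ∈ adom D}) : Monotone (ball D w) := by
  classical
  exact monotone_nat_of_le_succ fun _ => Finset.subset_union_left

open scoped Classical in
-- At most `degree D` facts contain `a`, and each has at most `A` values.
theorem card_neighbors_le {D : Database S V} {A : ℕ} (hA : ∀ R : S.Rel, S.ar R ≤ A)
    (a : {a : V // a ∈ adom D}) :
    (Finset.univ.filter fun b : {a : V // a ∈ adom D} =>
      Cooc (D : Set (Fact S V)) a.1 b.1).card ≤ degree D * A := by
  have h₁ : (D.filter fun f => ∃ i, f.2 i = a.1).card ≤ degree D :=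
    Finset.le_sup (f := fun a => (D.filter fun f => ∃ i, f.2 i = a).card) a.2
  refine le_trans ?_ (Nat.mul_le_mul_right A h₁)
  refine le_trans (Finset.card_le_card_of_injOn Subtype.val ?_ Subtype.val_injective.injOn)
    (Finset.card_biUnion_le_card_mul (D.filter fun f => ∃ i, f.2 i = a.1)
      (fun f => Finset.univ.image f.2) A fun f _ =>
        Finset.card_image_le.trans (by simpa using hA f.1))
  intro b hb
  obtain ⟨f, hf, hi, j, hj⟩ := (Finset.mem_filter.1 hb).2
  exact Finset.mem_biUnion.2 ⟨f, Finset.mem_filter.2 ⟨hf, hi⟩,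
    Finset.mem_image.2 ⟨j, Finset.mem_univ _, hj⟩⟩

theorem card_ball_le {D : Database S V} {A B : ℕ} (hA : ∀ R : S.Rel, S.ar R ≤ A)
    (hB : degree D ≤ B) (w : {a : V // a ∈ adom D}) (n : ℕ) :
    (ball D w n).card ≤ (1 + B * A) ^ n := by
  classical
  induction n with
  | zero => simp [ball]
  | succ n ih =>
    refine (Finset.card_union_le _ _).trans ?_
    have := Finset.card_biUnion_le_card_mul (ball D w n) _ (B * A) fun a _ =>
      (card_neighbors_le hA a).trans (Nat.mul_le_mul_right A hB)
    calc _ ≤ (ball D w n).card + (ball D w n).card * (B * A) := Nat.add_le_add_left this _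
      _ = (ball D w n).card * (1 + B * A) := by ring
      _ ≤ _ := by rw [pow_succ]; exact Nat.mul_le_mul_right _ ih

/-- A path from `x` in the pattern maps to a path in the database, of length independent of the
database. -/
theorem exists_radius {ι : Type} [Finite ι] {A : Set (Fact S ι)} {x : ι}
    (hA : ∀ a, Relation.ReflTransGen (Cooc A) x a) :
    ∃ r, ∀ (D : Database S V) (g : ι → {a : V // a ∈ adom D}),
      (∀ f ∈ A, Fact.map (fun a => (g a).1) f ∈ D) → ∀ a, g a ∈ ball D (g x) r := by
  have h : ∀ a, ∃ r, ∀ (D : Database S V) (g : ι → {a : V // a ∈ adom D}),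
      (∀ f ∈ A, Fact.map (fun a => (g a).1) f ∈ D) → g a ∈ ball D (g x) r := by
    classical
    intro a
    induction hA a with
    | refl => exact ⟨0, fun D g _ => Finset.mem_singleton_self _⟩
    | @tail b c _ hbc ih =>
      obtain ⟨r, hr⟩ := ih
      refine ⟨r + 1, fun D g hg => ?_⟩
      exact Finset.mem_union_right _ (Finset.mem_biUnion.2 ⟨g b, hr D g hg,
        Finset.mem_filter.2 ⟨Finset.mem_univ _, hbc.map (ρ := fun a => (g a).1) hg⟩⟩)
  choose r hr using h
  obtain ⟨R, hR⟩ := (Set.finite_range r).bddAbove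
  exact ⟨R, fun D g hg a => ball_mono D _ (hR ⟨a, rfl⟩) (hr a D g hg)⟩

/-- Connectedness confines the images to a ball about the distinguished value, and the degree bounds
its size. So finitely many threshold tuples suffice, and the count is the number of those whose
formula `ψ k` holds. -/
theorem homCountsDetermined_connectedGhmlClass (B : ℕ) (F : PointedDatabase S V)
    (hF : (gaifman F.db).Connected) :
    HomCountsDetermined (boundedDegree S V B) (connectedGhmlClass S V) id F := by
  intro Q hQ
  obtain ⟨m, A, p, h⟩ := exists_conj F Q
  choose φ hφc hφ using hQ
  have hlink := (p.gaifman_connected_iff.1 hF).2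
  obtain ⟨r, hr⟩ := exists_radius (V := V) (x := 0) fun a => hlink 0 a
  obtain ⟨a, ha⟩ := (Set.finite_range S.ar).bddAbove
  have hcov : adom (Set.toFinite A).toFinset = Finset.univ := by
    ext a
    simpa [mem_adom] using p.covered a
  have hconn : (gaifman (Set.toFinite A).toFinset).Connected := by
    refine (presentationOfAdomEqUniv _ hcov).gaifman_connected_iff.2 ⟨⟨0⟩, ?_⟩
    simpa using hlink
  let ψ : (Fin m → Fin ((1 + B * a) ^ r)) → GHML S := fun k =>
    .ex m (fun j => k j + 1) 1 (fun _ => (Set.toFinite A).toFinset) (fun _ => m + 1)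
      (fun _ => id) fun _ j => φ (p.e j)
  have hψ : ∀ k, {X : PointedDatabase S V | (ψ k).Sat X.db X.pt} ∈ connectedGhmlClass S V :=
    fun k => ⟨ψ k, ⟨fun j => Nat.le_add_left 1 _, fun _ => ⟨⟨hcov, hconn⟩, fun j => hφc _⟩⟩, rfl⟩
  refine (FinDetermined.pi fun k => FinDetermined.of_mem
    (f := fun X => (ψ k).Sat X.db X.pt) (hψ k) fun X _ => Iff.rfl).of_determined
    fun X hX Y hY hXY => ?_
  have hcard : ∀ X ∈ boundedDegree S V B, Nat.card {h : Hom F X //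
      ∀ a, (⟨X.db, h.1 a⟩ : PointedDatabase S V) ∈ Q a} =
      Nat.card {k // (ψ k).Sat X.db X.pt} := by
    intro X hX
    rw [h, card_eq_card_countBlock (C := (1 + B * a) ^ r) (ball X.db X.pt r : Set _)
      (by rw [Set.ncard_coe_finset]; exact card_ball_le (fun R => ha ⟨R, rfl⟩) hX _ _) _
      fun ys hys j => hr X.db _ hys.1 j.succ]
    simp only [ψ, GHML.Sat]
    simp [Fact.map, Function.comp_def, hφ]
  simp only [id, hcard X hX, hcard Y hY]
  simp only [fun k => congrFun hXY k]

end Definability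

/-! ### The inclusions between the classes -/

section Expressiveness

variable {S : Schema.{u}} {V : Type v}

theorem AtLeastAsExpressiveOn.of_subset {K : Set (PointedDatabase S V)}
    {C₁ C₂ : Set (ValueProperty S V)} (h : C₁ ⊆ C₂) : AtLeastAsExpressiveOn K C₂ C₁ :=
  fun P hP => ⟨P, h hP, fun _ _ => Iff.rfl⟩

theorem simpleMaxDHN_subset_maxDHN : simpleMaxDHN S V ⊆ maxDHN S V :=
  fun _ ⟨N, hN, hP⟩ => ⟨N, hN.1, hP⟩

theorem unfoClass_subset_simpleMaxDHN [Infinite V] : unfoClass S V ⊆ simpleMaxDHN S V := by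
  rintro _ ⟨φ, hφ, rfl⟩
  have h := (φ.hasNormalForm (V := V) (plain := True) aggSpec_max (fun h => absurd trivial h)
    fun _ => hφ).adjoinable aggSpec_max fun h => absurd trivial h
  obtain ⟨N, hN, -, hs, h⟩ := exists_network_of_adjoinable h
  exact ⟨N, ⟨hN, hs⟩, h⟩

theorem hmlClass_subset_unfoClass (R : S.Rel) : hmlClass S V ⊆ unfoClass S V := by
  rintro _ ⟨φ, rfl⟩
  obtain ⟨ψ, hψ, h⟩ := φ.unfoDefinable (V := V) R
  exact ⟨ψ, hψ, Set.ext fun X => (h X.db fun _ => X.pt).symm⟩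

theorem maxDHN_subset_hmlClass : maxDHN S V ⊆ hmlClass S V := by
  rintro _ ⟨N, hN, rfl⟩
  obtain ⟨P, hP, h⟩ := exists_mem_of_network (K := Set.univ) (fun _ _ _ => Set.mem_univ _)
    boolClosed_hmlClass (agg := maxAgg) (v := fun n => 0 < n) (good := fun _ => True)
    (fun M M' hM G => by
      simp only [Multiset.count_pos, eq_iff_iff] at hM
      simp only [maxAgg, Multiset.mem_map, hM])
    (fun F _ => homCountsDetermined_hmlClass F) N (hN.mono fun L h i => ⟨h i, trivial⟩)
  rwa [show {X | N.Accepts X} = P from Set.ext fun X => (h X (Set.mem_univ X)).symm]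

theorem unfocClass_subset_simpleSumDHN [Infinite V] : unfocClass S V ⊆ simpleSumDHN S V := by
  rintro _ ⟨φ, rfl⟩
  have h := (φ.hasNormalForm (V := V) (plain := False) aggSpec_sum (fun _ => rfl)
    False.elim).adjoinable aggSpec_sum fun _ => rfl
  obtain ⟨N, hN, -, hs, h⟩ := exists_network_of_adjoinable h
  exact ⟨N, ⟨hN, hs⟩, h⟩

theorem ghmlClass_subset_simpleSumDHN [Infinite V] : ghmlClass S V ⊆ simpleSumDHN S V := by
  rintro _ ⟨φ, rfl⟩
  obtain ⟨N, hN, -, hs, h⟩ := exists_network_of_adjoinable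
    (φ.adjoinable (V := V) (conn := False) aggSpec_sum False.elim)
  exact ⟨N, ⟨hN, hs⟩, h⟩

theorem connectedGhmlClass_subset_simpleConnectedSumDHN [Infinite V] :
    connectedGhmlClass S V ⊆ simpleConnectedSumDHN S V := by
  rintro _ ⟨φ, hφ, rfl⟩
  obtain ⟨N, hN, hc, hs, h⟩ := exists_network_of_adjoinable
    (φ.adjoinable (V := V) (conn := True) aggSpec_sum fun _ => hφ)
  exact ⟨N, ⟨hN, hc trivial, hs⟩, h⟩

theorem simpleConnectedSumDHN_subset_connectedSumDHN :
    simpleConnectedSumDHN S V ⊆ connectedSumDHN S V :=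
  fun _ ⟨N, hN, hP⟩ => ⟨N, ⟨hN.1, hN.2.1⟩, hP⟩

theorem Layers.All.and {P Q : ∀ {d d' : ℕ}, Layer S V d d' → Prop} {d : ℕ} {N : Layers S V d}
    (hP : N.All P) (hQ : N.All Q) : N.All fun L => P L ∧ Q L := by
  induction N with
  | nil => trivial
  | snoc N L ih => exact ⟨ih hP.1 hQ.1, hP.2, hQ.2⟩

theorem connectedGhmlClass_expressive_on_boundedDegree (B : ℕ) :
    AtLeastAsExpressiveOn (boundedDegree S V B) (connectedGhmlClass S V)
      (connectedSumDHN S V) := by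
  rintro _ ⟨N, ⟨hN, hc⟩, rfl⟩
  exact exists_mem_of_network (fun X hX _ => hX) boolClosed_connectedGhmlClass (agg := sumAgg)
    (v := id) (good := fun F => (gaifman F.db).Connected)
    (fun M M' hM G => by rw [Multiset.ext.2 hM])
    (homCountsDetermined_connectedGhmlClass B) N
    ((Layers.All.and hN hc).mono fun L h i => ⟨h.1 i, h.2 i⟩)

end Expressiveness

end HomNet

open HomNet
theorem theorem1 (S : Schema) (V : Type*) [Countable V] [Infinite V]
    (hS : ∃ R : S.Rel, 0 < S.ar R) :
    (SameExpressivePower (maxDHN S V) (simpleMaxDHN S V) ∧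
      SameExpressivePower (maxDHN S V) (unfoClass S V) ∧
      SameExpressivePower (maxDHN S V) (hmlClass S V)) ∧
    (AtLeastAsExpressive (simpleSumDHN S V) (ghmlClass S V) ∧
      AtLeastAsExpressive (simpleSumDHN S V) (unfocClass S V)) ∧
    ∀ B : ℕ,
      SameExpressivePowerOn (boundedDegree S V B)
        (connectedSumDHN S V) (simpleConnectedSumDHN S V) ∧
      SameExpressivePowerOn (boundedDegree S V B)
        (connectedSumDHN S V) (connectedGhmlClass S V) := by
  obtain ⟨R, -⟩ := hS
  have h₁ : hmlClass S V ⊆ unfoClass S V := hmlClass_subset_unfoClass R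
  have h₂ : unfoClass S V ⊆ simpleMaxDHN S V := unfoClass_subset_simpleMaxDHN
  have h₃ : simpleMaxDHN S V ⊆ maxDHN S V := simpleMaxDHN_subset_maxDHN
  have h₄ : maxDHN S V ⊆ hmlClass S V := maxDHN_subset_hmlClass
  have h₅ : connectedGhmlClass S V ⊆ simpleConnectedSumDHN S V :=
    connectedGhmlClass_subset_simpleConnectedSumDHN
  have h₆ : simpleConnectedSumDHN S V ⊆ connectedSumDHN S V :=
    simpleConnectedSumDHN_subset_connectedSumDHN
  refine ⟨⟨⟨.of_subset h₃, .of_subset (h₄.trans (h₁.trans h₂))⟩,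
    ⟨.of_subset (h₂.trans h₃), .of_subset (h₄.trans h₁)⟩,
    .of_subset (h₁.trans (h₂.trans h₃)), .of_subset h₄⟩,
    ⟨.of_subset ghmlClass_subset_simpleSumDHN, .of_subset unfocClass_subset_simpleSumDHN⟩,
    fun B => ⟨⟨.of_subset h₆, fun P hP => ?_⟩, .of_subset (h₅.trans h₆),
      connectedGhmlClass_expressive_on_boundedDegree B⟩⟩
  -- A connected sum-DHN is made simple by way of an equivalent connected formula.
  obtain ⟨Q, hQ, h⟩ := connectedGhmlClass_expressive_on_boundedDegree B P hP
  exact ⟨Q, h₅ hQ, h⟩
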